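/- Consider the following market. A monopolist discounts at rate $r>0$ and sells a safe product (flow utility $s$) or a risky product, whose state is good or bad. In the good state the risky product yields a lump sum $z$ at arrival rate $\lambda>0$, in the bad state nothing; put $g=\lambda z$ and assume $g>s>0$. Buyers arrive continuously, with i.i.d. reporting costs whose distribution function $H$ has a continuous positive density $h$ on $[0,\bar c]$, where $\bar c>(\frac{\lambda}{r}+1)(g-s)$; assume that $\beta(x)=x+H(x)/h(x)$ is continuously differentiable with $\beta'>0$ on $(0,\bar c)$. At each moment the seller chooses which arm to promote and a bonus $b\in[0,\bar c]$; buyers with cost at most $b$ buy the risky product and report, the others buy the promoted product without reporting, all at fair prices. Thus at belief $\alpha$ (the probability of the good state) the profit flow is $\lambda\alpha z-H(b)b$ if the risky arm is promoted and $H(b)(\lambda\alpha z-b)+(1-H(b))s$ if the safe arm is promoted. Good news is reported at rate $\lambda\alpha H(b)$ and is then worth $\lambda z/r$; in its absence the belief follows Bayes' rule, $\dot\alpha=-\lambda\alpha(1-\alpha)H(b)$. The strategies are called Full Coverage (risky arm promoted, $0<b<\bar c$), Non Bonus (risky arm promoted, $b=0$), Partial Coverage (safe arm promoted, $0<b<\bar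 c$) and Safe Arm (safe arm promoted, $b=0$). Let $\Pi(\alpha)$ be the maximal expected discounted lifetime profit of the seller at belief $\alpha$. Then there are cutoffs $0<\alpha_{SA}^{PC}<\alpha_{PC}^{FC}<\alpha_{FC}^{NB}<1$ with $$\alpha_{SA}^{PC}=\frac{sr}{\lambda(g-s)+rg},\qquad \alpha_{PC}^{FC}=\frac{s}{\lambda z},$$ and $\alpha_{FC}^{NB}$ the smallest solution $x\in(0,1)$ of $\Pi(x)=xz\lambda/r$, such that the following holds. (a) $\Pi$ is continuously differentiable on $(0,1)$, in particular its branches are pasted smoothly at the three cutoffs, and on $(0,1)$ it satisfies the Bellman equation $$r\Pi(\alpha)=\max\Big\{\pi+H(b)\Big[\frac{\alpha\lambda^2z}{r}-\alpha\lambda\Pi(\alpha)+(\alpha^2-\alpha)\lambda\Pi'(\alpha)\Big]\Big\},$$ the maximum being over the promoted arm and $b\in[0,\bar c]$, with $\pi$ the corresponding profit flow. Moreover $\Pi=s/r$ on $(0,\alpha_{SA}^{PC}]$; on $[\alpha_{SA}^{PC},\alpha_{PC}^{FC}]$ the equation holds with the maximum restricted to promoting the safe arm; on $[\alpha_{PC}^{FC},\alpha_{FC}^{NB}]$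 it holds with the maximum restricted to promoting the risky arm; and $\Pi(\alpha)=\alpha z\lambda/r$ on $[\alpha_{FC}^{NB},1)$. (b) Every maximizer of the Bellman equation at $\alpha$ is Safe Arm if $0<\alpha<\alpha_{SA}^{PC}$, Partial Coverage if $\alpha_{SA}^{PC}<\alpha<\alpha_{PC}^{FC}$, Full Coverage if $\alpha_{PC}^{FC}<\alpha<\alpha_{FC}^{NB}$, and Non Bonus if $\alpha_{FC}^{NB}<\alpha<1$. Some policy depending only on the belief and selecting such maximizers attains the maximal lifetime profit from every prior in $(0,1)$, and every optimal plan uses, at almost every time before good news is reported, the strategy so prescribed at the current belief. -/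

import Mathlib

open Set MeasureTheory

noncomputable section

/-- Primitives of the exponential-bandit market with costly reporting: discount rate `r`, arrival
rate `lam` of the lump sum `z` in the good state, flow utility `s` of the safe arm, and the density
`h` of the reporting cost on `[0, cbar]`. -/
structure Market where
  r : ℝ
  lam : ℝ
  z : ℝ
  s : ℝ
  cbar : ℝ
  h : ℝ → ℝ

/-- The product sold to buyers who do not report. -/
inductive Arm where
  | risky
  | safe

/-- A stage action of the seller: the promoted arm and the (normalized) reporting bonus. -/
structure StageAction where
  arm : Arm
  bonus : ℝ

namespace Market

/-- Flow utility of the risky arm when the state is known to be good. -/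
def g (M : Market) : ℝ := M.lam * M.z

/-- Distribution function of the reporting cost (used on `[0, cbar]` only).  A buyer reports iff his
cost is at most the bonus, so `H b` is also the probability of a report under the bonus `b`. -/
def H (M : Market) (x : ℝ) : ℝ := ∫ t in (0 : ℝ)..x, M.h t

/-- The virtual cost. -/
def beta (M : Market) (x : ℝ) : ℝ := x + M.H x / M.h x

/-- The standing assumptions of the model. -/
structure Standing (M : Market) : Prop where
  r_pos : 0 < M.r
  lam_pos : 0 < M.lam
  s_pos : 0 < M.s
  s_lt_g : M.s < M.g
  cbar_large : (M.lam / M.r + 1) * (M.g - M.s) < M.cbar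
  h_continuous : ContinuousOn M.h (Icc 0 M.cbar)
  h_pos : ∀ x ∈ Icc 0 M.cbar, 0 < M.h x
  h_total : M.H M.cbar = 1
  beta_contDiff : ContDiffOn ℝ 1 M.beta (Ioo 0 M.cbar)
  beta_deriv_pos : ∀ x ∈ Ioo 0 M.cbar, 0 < deriv M.beta x

def Feasible (M : Market) (a : StageAction) : Prop := a.bonus ∈ Icc 0 M.cbar

/-! The four strategies. -/

def IsSafeArm (_M : Market) (a : StageAction) : Prop := a.arm = Arm.safe ∧ a.bonus = 0

def IsPartialCoverage (M : Market) (a : StageAction) : Prop :=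
  a.arm = Arm.safe ∧ 0 < a.bonus ∧ a.bonus < M.cbar

def IsFullCoverage (M : Market) (a : StageAction) : Prop :=
  a.arm = Arm.risky ∧ 0 < a.bonus ∧ a.bonus < M.cbar

def IsNonBonus (_M : Market) (a : StageAction) : Prop := a.arm = Arm.risky ∧ a.bonus = 0

/-- Expected profit flow at belief `α`.  If the risky arm is promoted, every buyer buys it at its
fair price; if the safe arm is promoted, only the reporting buyers buy the risky arm. -/
def flow (M : Market) (α : ℝ) (a : StageAction) : ℝ :=
  match a.arm with
  | Arm.risky => M.lam * α * M.z - M.H a.bonus * a.bonus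
  | Arm.safe => M.H a.bonus * (M.lam * α * M.z - a.bonus) + (1 - M.H a.bonus) * M.s

/-- A plan: the action `act t` is used at time `t ≥ 0` as long as no good news has been reported.
(Until then the public belief moves deterministically, so this covers every path generated by a
policy depending on the belief; after good news the seller sells the risky arm forever.) -/
structure Plan (M : Market) where
  act : ℝ → StageAction
  arm_measurable : MeasurableSet {t | (act t).arm = Arm.risky}
  bonus_measurable : Measurable fun t => (act t).bonus
  feasible : ∀ t, M.Feasible (act t)

variable {M : Market}

/-- Cumulated amount of reported experimentation up to time `t`. -/
def Plan.reports (P : M.Plan) (t : ℝ) : ℝ := ∫ u in (0 : ℝ)..t, M.H (P.act u).bonus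

/-- Probability, with prior `α₀`, that no good news has been reported up to time `t`. -/
def Plan.noNews (P : M.Plan) (α₀ t : ℝ) : ℝ := α₀ * Real.exp (-M.lam * P.reports t) + (1 - α₀)

/-- Posterior (Bayes) belief in the good state at time `t` if no good news has been reported. -/
def Plan.belief (P : M.Plan) (α₀ t : ℝ) : ℝ :=
  α₀ * Real.exp (-M.lam * P.reports t) / P.noNews α₀ t

/-- Expected discounted lifetime profit of a plan at prior `α₀`: good news is reported at rate
`H(b) α λ`, and is then worth `λ z / r`. -/
def Plan.profit (P : M.Plan) (α₀ : ℝ) : ℝ :=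
  ∫ t in Ioi (0 : ℝ), Real.exp (-M.r * t) * P.noNews α₀ t *
    (M.flow (P.belief α₀ t) (P.act t) +
      M.H (P.act t).bonus * (P.belief α₀ t * M.lam) * (M.lam * M.z / M.r))

/-- The plan maximizes the lifetime profit at prior `α₀` among all plans. -/
def Plan.IsOptimal (P : M.Plan) (α₀ : ℝ) : Prop := ∀ Q : M.Plan, Q.profit α₀ ≤ P.profit α₀

variable (M)

/-- The value function of the optimally switching monopolist. -/
def value (α : ℝ) : ℝ := ⨆ P : M.Plan, P.profit α

/-- The right-hand side of the Bellman equation for the candidate value function `W`. -/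
def bellman (W : ℝ → ℝ) (α : ℝ) (a : StageAction) : ℝ :=
  M.flow α a + M.H a.bonus * (α * M.lam ^ 2 * M.z / M.r) - M.H a.bonus * α * M.lam * W α
    + M.H a.bonus * (α ^ 2 - α) * M.lam * deriv W α

/-- `a` attains the maximum in the Bellman equation at belief `α`. -/
def IsBellmanOptimal (W : ℝ → ℝ) (α : ℝ) (a : StageAction) : Prop :=
  M.Feasible a ∧ ∀ a', M.Feasible a' → M.bellman W α a' ≤ M.bellman W α a

/-- The Bellman equation `r W(α) = max_{(ℓ, b)} …`, maximum attained. -/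
def BellmanEq (W : ℝ → ℝ) (α : ℝ) : Prop :=
  IsGreatest (M.bellman W α '' {a | M.Feasible a}) (M.r * W α)

/-- The Bellman equation when only the given arm may be promoted: for `Arm.risky` the
Full Coverage ODE, for `Arm.safe` the Partial Coverage ODE. -/
def ArmEq (ℓ : Arm) (W : ℝ → ℝ) (α : ℝ) : Prop :=
  IsGreatest ((fun b => M.bellman W α ⟨ℓ, b⟩) '' Icc 0 M.cbar) (M.r * W α)

/-- The action is of the type that the cutoff rule prescribes at belief `α`. -/
def Prescribed (αSP αPF αFN α : ℝ) (a : StageAction) : Prop :=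
  (α ∈ Ioo 0 αSP → M.IsSafeArm a) ∧
  (α ∈ Ioo αSP αPF → M.IsPartialCoverage a) ∧
  (α ∈ Ioo αPF αFN → M.IsFullCoverage a) ∧
  (α ∈ Ioo αFN 1 → M.IsNonBonus a)

end Market

end

/-!
Let `W` be the value function and let
`y = λ α (g / r - W α - (1 - α) W' α) + g α - max (g α) s`: what a good report adds to the
continuation value, corrected for the slower decline of the belief without it, less the flow that a
buyer of the safe product forgoes when induced to buy the risky one. The Bellman equation reads
`r W α = max (g α) s + φ y` with `φ y = max_b H(b) (y - b)`. Inverting `φ` on the nonnegative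
half-line gives a first-order equation with a continuous right-hand side in the log-odds of the
belief. As `φ` is quadratic at `0`, its inverse behaves like a square root there, so the equation is
not Lipschitz where `r W α = max (g α) s`, and a solution is provided by Peano's theorem. The same
square root makes the solution that leaves the safe value at `αSP` reach the value of the risky arm
at a belief below `1`. This belief is the cutoff `αFN`, and the pasting there is smooth since `y`
vanishes on both sides.

Along any plan, the derivative of `exp (-r t) * P(no news by t) * W(belief at t)` integrates to
`profit = W α₀ - ∫ weight * shortfall`, where the shortfall is the amount by which the current
action misses the maximum in the Bellman equation. Hence `W` dominates every profit, with equality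
exactly when the action is a Bellman maximizer at almost every time. The belief under the maximizing
policy solves an equation that need not be Lipschitz either, and Peano's theorem applies again.
-/

open Filter Topology

/-! ### Comparison and existence for scalar differential equations -/

theorem le_barrier_of_deriv_nonpos {f f' u : ℝ → ℝ} {a b : ℝ}
    (hf : ContinuousOn f (Icc a b)) (hu : ContinuousOn u (Icc a b)) (hum : MonotoneOn u (Icc a b))
    (hd : ∀ x ∈ Ioo a b, HasDerivAt f (f' x) x) (ha : f a ≤ u a)
    (hneg : ∀ x ∈ Ioo a b, u x < f x → f' x ≤ 0) : ∀ x ∈ Icc a b, f x ≤ u x := by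
  intro x₁ hx₁
  by_contra! hlt
  have hsub : Icc a x₁ ⊆ Icc a b := Icc_subset_Icc_right hx₁.2
  set S : Set ℝ := {x ∈ Icc a x₁ | f x ≤ u x}
  have hSc : IsCompact S :=
    isCompact_Icc.of_isClosed_subset
      (isClosed_Icc.isClosed_le (hf.mono hsub) (hu.mono hsub)) (sep_subset _ _)
  obtain ⟨⟨h₀a, h₀x⟩, h₀⟩ := hSc.sSup_mem ⟨a, ⟨le_rfl, hx₁.1⟩, ha⟩
  set x₀ := sSup S
  have habove : ∀ x ∈ Ioc x₀ x₁, u x < f x := by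
    intro x hx
    by_contra! h
    exact absurd (le_csSup hSc.bddAbove (show x ∈ S from ⟨⟨h₀a.trans hx.1.le, hx.2⟩, h⟩))
      (not_le.2 hx.1)
  have hanti : AntitoneOn f (Icc x₀ x₁) := by
    refine antitoneOn_of_hasDerivWithinAt_nonpos (f' := f') (convex_Icc _ _)
      (hf.mono (Icc_subset_Icc h₀a hx₁.2)) (fun x hx => ?_) (fun x hx => ?_) <;>
      rw [interior_Icc] at hx
    · exact (hd x ⟨h₀a.trans_lt hx.1, hx.2.trans_le hx₁.2⟩).hasDerivWithinAt
    · exact hneg x ⟨h₀a.trans_lt hx.1, hx.2.trans_le hx₁.2⟩ (habove x ⟨hx.1, hx.2.le⟩)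
  have h1 := hanti (left_mem_Icc.2 h₀x) (right_mem_Icc.2 h₀x) h₀x
  have h2 := hum ⟨h₀a, h₀x.trans hx₁.2⟩ hx₁ h₀x
  linarith

section LipschitzEnvelope

variable {X : Type*} [PseudoMetricSpace X] {F : X → ℝ} {c : ℝ}

/-- The Pasch–Hausdorff envelope of `F`: its largest `K`-Lipschitz minorant. It approximates a
continuous function from below by Lipschitz ones. -/
noncomputable def lipschitzEnvelope (F : X → ℝ) (K : ℝ) (x : X) : ℝ := ⨅ y, (F y + K * dist x y)

theorem lipschitzEnvelope_bddBelow (hF : ∀ y, c ≤ F y) {K : ℝ} (hK : 0 ≤ K) (x : X) :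
    BddBelow (range fun y => F y + K * dist x y) :=
  ⟨c, forall_mem_range.2 fun y => by linarith [hF y, mul_nonneg hK (dist_nonneg (x := x) (y := y))]⟩

theorem lipschitzEnvelope_le (hF : ∀ y, c ≤ F y) {K : ℝ} (hK : 0 ≤ K) (x : X) :
    lipschitzEnvelope F K x ≤ F x :=
  (ciInf_le (lipschitzEnvelope_bddBelow hF hK x) x).trans_eq (by simp)

theorem le_lipschitzEnvelope (hF : ∀ y, c ≤ F y) {K : ℝ} (hK : 0 ≤ K) (x : X) :
    c ≤ lipschitzEnvelope F K x :=
  have : Nonempty X := ⟨x⟩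
  le_ciInf fun y => by linarith [hF y, mul_nonneg hK (dist_nonneg (x := x) (y := y))]

theorem abs_lipschitzEnvelope_le (hF : ∀ y, |F y| ≤ c) {K : ℝ} (hK : 0 ≤ K) (x : X) :
    |lipschitzEnvelope F K x| ≤ c :=
  have hF' : ∀ y, -c ≤ F y := fun y => (abs_le.1 (hF y)).1
  abs_le.2 ⟨le_lipschitzEnvelope hF' hK x,
    (lipschitzEnvelope_le hF' hK x).trans (abs_le.1 (hF x)).2⟩

theorem lipschitzEnvelope_mono (hF : ∀ y, c ≤ F y) {K L : ℝ} (hK : 0 ≤ K) (hKL : K ≤ L) (x : X) :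
    lipschitzEnvelope F K x ≤ lipschitzEnvelope F L x :=
  ciInf_mono (lipschitzEnvelope_bddBelow hF hK x) fun y => by gcongr

theorem lipschitzWith_lipschitzEnvelope (hF : ∀ y, c ≤ F y) (K : NNReal) :
    LipschitzWith K (lipschitzEnvelope F K) :=
  LipschitzWith.of_le_add_mul K fun x x' => by
    have : Nonempty X := ⟨x⟩
    rw [← sub_le_iff_le_add]
    refine le_ciInf fun y => ?_
    have hx := ciInf_le (lipschitzEnvelope_bddBelow hF K.2 x) y
    have htri := mul_le_mul_of_nonneg_left (dist_triangle x x' y) K.2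
    change lipschitzEnvelope F K x ≤ _ at hx
    simp only [NNReal.val_eq_coe] at *
    linarith

theorem tendsto_lipschitzEnvelope (hF : ∀ y, c ≤ F y) {x : X} (hx : ContinuousAt F x)
    {u : ℕ → X} (hu : Tendsto u atTop (𝓝 x)) :
    Tendsto (fun n : ℕ => lipschitzEnvelope F n (u n)) atTop (𝓝 (F x)) := by
  have hle : ∀ n : ℕ, lipschitzEnvelope F n (u n) ≤ F (u n) := fun n =>
    lipschitzEnvelope_le hF n.cast_nonneg _
  refine tendsto_order.2 ⟨fun a ha => ?_, fun a ha => ?_⟩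
  · obtain ⟨b, hab, hb⟩ := exists_between ha
    obtain ⟨δ, hδ, hball⟩ := Metric.eventually_nhds_iff.1 (hx.eventually_const_lt hb)
    have hfar : ∀ᶠ n : ℕ in atTop, b ≤ c + n * (δ / 2) :=
      (tendsto_const_nhds.add_atTop
        (tendsto_natCast_atTop_atTop.atTop_mul_const (half_pos hδ))).eventually_ge_atTop b
    filter_upwards [hfar, hu (Metric.ball_mem_nhds x (half_pos hδ))] with n hn hun
    have : Nonempty X := ⟨x⟩
    refine hab.trans_le (le_ciInf fun y => ?_)
    rcases lt_or_ge (dist y x) δ with hy | hy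
    · linarith [hball hy, mul_nonneg n.cast_nonneg (dist_nonneg (x := u n) (y := y))]
    · have hdist : δ / 2 ≤ dist (u n) y := by
        have h1 : dist (u n) x < δ / 2 := hun
        linarith [dist_triangle_left y x (u n)]
      linarith [hF y, mul_le_mul_of_nonneg_left hdist n.cast_nonneg]
  · filter_upwards [(hx.tendsto.comp hu).eventually_lt_const ha] with n hn
    exact (hle n).trans_lt hn

end LipschitzEnvelope

section ODE

variable {F G : ℝ → ℝ → ℝ} {C t₀ T : ℝ}

theorem exists_solution_of_lipschitz {K : NNReal}
    (hcont : Continuous (Function.uncurry F)) (hlip : ∀ t, LipschitzWith K (F t))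
    (hbdd : ∀ t x, |F t x| ≤ C) (hT : t₀ ≤ T) (x₀ : ℝ) :
    ∃ E : ℝ → ℝ, E t₀ = x₀ ∧
      ∀ t ∈ Icc t₀ T, HasDerivWithinAt E (F t (E t)) (Icc t₀ T) t := by
  have hC : 0 ≤ C := (abs_nonneg _).trans (hbdd 0 0)
  have hpl : IsPicardLindelof F (⟨t₀, left_mem_Icc.2 hT⟩ : Icc t₀ T) x₀
      (⟨C, hC⟩ * ⟨T - t₀, sub_nonneg.2 hT⟩) 0 ⟨C, hC⟩ K :=
    { lipschitzOnWith := fun t _ => (hlip t).lipschitzOnWith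
      continuousOn := fun x _ =>
        (hcont.comp (by fun_prop : Continuous fun t => (t, x))).continuousOn
      norm_le := fun t _ x _ => hbdd t x
      mul_max_le := by
        rw [sub_self, max_eq_left (sub_nonneg.2 hT), NNReal.coe_zero, sub_zero]
        exact le_rfl }
  exact hpl.exists_eq_forall_mem_Icc_hasDerivWithinAt₀

theorem solution_le_solution {K : NNReal} (hFG : ∀ t x, F t x ≤ G t x)
    (hlip : ∀ t, LipschitzWith K (G t)) {E D : ℝ → ℝ}
    (hE : ∀ t ∈ Icc t₀ T, HasDerivWithinAt E (F t (E t)) (Icc t₀ T) t)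
    (hD : ∀ t ∈ Icc t₀ T, HasDerivWithinAt D (G t (D t)) (Icc t₀ T) t) (h₀ : E t₀ = D t₀) :
    ∀ t ∈ Icc t₀ T, E t ≤ D t := by
  have hcont : ContinuousOn (fun t => Real.exp (-K * t) * (E t - D t)) (Icc t₀ T) :=
    (by fun_prop : Continuous fun t : ℝ => Real.exp (-K * t)).continuousOn.mul
      ((HasDerivWithinAt.continuousOn hE).sub (HasDerivWithinAt.continuousOn hD))
  have hderiv : ∀ t ∈ Ioo t₀ T, HasDerivAt (fun t => Real.exp (-K * t) * (E t - D t))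
      (Real.exp (-K * t) * (F t (E t) - G t (D t) - K * (E t - D t))) t := by
    intro t ht
    have hmem := Icc_mem_nhds ht.1 ht.2
    have hexp := ((hasDerivAt_id t).const_mul (-(K : ℝ))).exp
    refine (hexp.mul (((hE t (Ioo_subset_Icc_self ht)).hasDerivAt hmem).sub
      ((hD t (Ioo_subset_Icc_self ht)).hasDerivAt hmem))).congr_deriv ?_
    simp only [id_eq, Pi.sub_apply]
    ring
  have hneg : ∀ t ∈ Ioo t₀ T, 0 < Real.exp (-K * t) * (E t - D t) →
      Real.exp (-K * t) * (F t (E t) - G t (D t) - K * (E t - D t)) ≤ 0 := by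
    intro t _ hpos
    have hDE : D t < E t := sub_pos.1 ((pos_iff_pos_of_mul_pos hpos).1 (Real.exp_pos _))
    have hG := (hlip t).dist_le_mul (E t) (D t)
    rw [Real.dist_eq, Real.dist_eq, abs_of_pos (sub_pos.2 hDE)] at hG
    refine mul_nonpos_of_nonneg_of_nonpos (Real.exp_pos _).le ?_
    linarith [hFG t (E t), le_abs_self (G t (E t) - G t (D t))]
  intro t ht
  have hle := le_barrier_of_deriv_nonpos hcont (continuousOn_const (c := (0 : ℝ)))
    monotoneOn_const hderiv (by simp [h₀]) hneg t ht
  exact sub_nonpos.1 (nonpos_of_mul_nonpos_right hle (Real.exp_pos _))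

theorem dist_solution_le (hbdd : ∀ t x, |F t x| ≤ C) {E : ℝ → ℝ}
    (hE : ∀ t ∈ Icc t₀ T, HasDerivWithinAt E (F t (E t)) (Icc t₀ T) t) {t t' : ℝ}
    (ht : t ∈ Icc t₀ T) (ht' : t' ∈ Icc t₀ T) : |E t' - E t| ≤ C * |t' - t| :=
  (convex_Icc t₀ T).norm_image_sub_le_of_norm_hasDerivWithin_le hE (fun s _ => hbdd s _) ht ht'

theorem exists_tendsto_solution_of_monotone {G : ℕ → ℝ → ℝ → ℝ} {K : ℕ → NNReal}
    (hcont : ∀ n, Continuous (Function.uncurry (G n))) (hlip : ∀ n t, LipschitzWith (K n) (G n t))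
    (hbdd : ∀ n t x, |G n t x| ≤ C) (hmono : Monotone G) (t₀ x₀ : ℝ) :
    ∃ (E : ℕ → ℝ → ℝ) (e : ℝ → ℝ), (∀ n, E n t₀ = x₀) ∧
      (∀ n : ℕ, ∀ t ∈ Icc t₀ (t₀ + n),
        HasDerivWithinAt (E n) (G n t (E n t)) (Icc t₀ (t₀ + n)) t) ∧
      ∀ t, t₀ ≤ t → Tendsto (fun n => E n t) atTop (𝓝 (e t)) := by
  choose E hE₀ hE using fun n : ℕ => exists_solution_of_lipschitz (hcont n) (hlip n) (hbdd n)
    (le_add_of_nonneg_right (a := t₀) n.cast_nonneg) x₀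
  have hEmono : ∀ {m n : ℕ}, m ≤ n → ∀ t ∈ Icc t₀ (t₀ + m), E m t ≤ E n t := by
    intro m n hmn
    have hsub : Icc t₀ (t₀ + m) ⊆ Icc t₀ (t₀ + n) := by gcongr
    exact solution_le_solution (hmono hmn) (hlip n) (hE m)
      (fun t ht => (hE n t (hsub ht)).mono hsub) ((hE₀ m).trans (hE₀ n).symm)
  have hlim : ∀ t, t₀ ≤ t → ∃ l, Tendsto (fun n => E n t) atTop (𝓝 l) := by
    intro t ht
    obtain ⟨k, hk⟩ := exists_nat_ge (t - t₀)
    have hmem : ∀ n, t ∈ Icc t₀ (t₀ + (n + k : ℕ)) := fun n =>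
      ⟨ht, by push_cast; linarith [n.cast_nonneg (α := ℝ)]⟩
    have hupper : ∀ n, E (n + k) t ≤ x₀ + C * |t - t₀| := fun n => by
      have := (abs_le.1 (dist_solution_le (hbdd _) (hE (n + k))
        (left_mem_Icc.2 ((hmem n).1.trans (hmem n).2)) (hmem n))).2
      linarith [hE₀ (n + k)]
    exact ⟨_, (tendsto_add_atTop_iff_nat k).1 (tendsto_atTop_ciSup
      (monotone_nat_of_le_succ fun n => hEmono (by lia) t (hmem n))
      ⟨_, forall_mem_range.2 hupper⟩)⟩
  choose! e he using hlim
  exact ⟨E, e, hE₀, hE, he⟩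

theorem lipschitzOnWith_of_tendsto_solution {G : ℕ → ℝ → ℝ → ℝ} {E : ℕ → ℝ → ℝ} {e : ℝ → ℝ}
    {C : NNReal} (hbdd : ∀ n t x, |G n t x| ≤ C)
    (hE : ∀ n : ℕ, ∀ t ∈ Icc t₀ (t₀ + n),
      HasDerivWithinAt (E n) (G n t (E n t)) (Icc t₀ (t₀ + n)) t)
    (he : ∀ t, t₀ ≤ t → Tendsto (fun n => E n t) atTop (𝓝 (e t))) :
    LipschitzOnWith C e (Ici t₀) := by
  refine LipschitzOnWith.of_dist_le_mul fun t ht t' ht' => ?_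
  refine le_of_tendsto ((he t ht).dist (he t' ht')) ?_
  filter_upwards [tendsto_natCast_atTop_atTop.eventually_ge_atTop (t - t₀),
    tendsto_natCast_atTop_atTop.eventually_ge_atTop (t' - t₀)] with n hn hn'
  exact dist_solution_le (hbdd n) (hE n) ⟨ht', by linarith⟩ ⟨ht, by linarith⟩

theorem eq_integral_of_tendsto_solution {G : ℕ → ℝ → ℝ → ℝ} {E : ℕ → ℝ → ℝ} {e : ℝ → ℝ} {x₀ : ℝ}
    (hcont : ∀ n, Continuous (Function.uncurry (G n))) (hbdd : ∀ n t x, |G n t x| ≤ C)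
    (hE₀ : ∀ n, E n t₀ = x₀)
    (hE : ∀ n : ℕ, ∀ t ∈ Icc t₀ (t₀ + n),
      HasDerivWithinAt (E n) (G n t (E n t)) (Icc t₀ (t₀ + n)) t)
    (he : ∀ t, t₀ ≤ t → Tendsto (fun n => E n t) atTop (𝓝 (e t)))
    (hG : ∀ t, t₀ ≤ t → Tendsto (fun n => G n t (E n t)) atTop (𝓝 (F t (e t)))) {t : ℝ}
    (ht : t₀ ≤ t) : e t = x₀ + ∫ s in t₀..t, F s (e s) := by
  have hlong : ∀ᶠ n : ℕ in atTop, t ≤ t₀ + n := by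
    filter_upwards [tendsto_natCast_atTop_atTop.eventually_ge_atTop (t - t₀)] with n hn
    linarith
  have hGcont : ∀ n : ℕ, t ≤ t₀ + n → ContinuousOn (fun s => G n s (E n s)) (Icc t₀ t) :=
    fun n hn => (hcont n).comp_continuousOn (continuousOn_id.prodMk
      ((HasDerivWithinAt.continuousOn (hE n)).mono (Icc_subset_Icc_right hn)))
  have hint : ∀ᶠ n : ℕ in atTop, x₀ + ∫ s in t₀..t, G n s (E n s) = E n t := by
    filter_upwards [hlong] with n hn
    have hderiv : ∀ s ∈ Ioo t₀ t, HasDerivAt (E n) (G n s (E n s)) s := fun s hs =>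
      (hE n s ⟨hs.1.le, hs.2.le.trans hn⟩).hasDerivAt (Icc_mem_nhds hs.1 (hs.2.trans_le hn))
    rw [intervalIntegral.integral_eq_sub_of_hasDerivAt_of_le ht
      ((HasDerivWithinAt.continuousOn (hE n)).mono (Icc_subset_Icc_right hn)) hderiv
      ((hGcont n hn).intervalIntegrable_of_Icc ht), hE₀, add_sub_cancel]
  refine tendsto_nhds_unique (he t ht) (Tendsto.congr' hint (Tendsto.const_add _ ?_))
  refine intervalIntegral.tendsto_integral_filter_of_dominated_convergence (fun _ => C)
    (hlong.mono fun n hn => ?_) (.of_forall fun n => .of_forall fun s _ => hbdd n s _)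
    intervalIntegrable_const (.of_forall fun s hs => hG s ?_)
  · rw [uIoc_of_le ht]
    exact ((hGcont n hn).mono Ioc_subset_Icc_self).aestronglyMeasurable measurableSet_Ioc
  · exact (uIoc_of_le ht ▸ hs).1.le

/-- **Peano's theorem**, by monotone approximation: the Lipschitz envelopes of `F` increase to `F`,
hence the solutions they define increase as well. Before `t₀` the unknown is frozen at its initial
value. -/
theorem exists_forward_solution (hcont : Continuous (Function.uncurry F))
    (hbdd : ∀ t x, |F t x| ≤ C) (t₀ x₀ : ℝ) :
    ∃ E : ℝ → ℝ, E t₀ = x₀ ∧ ∀ t, HasDerivAt E (F t (E (max t t₀))) t := by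
  have hF : ∀ p, |Function.uncurry F p| ≤ C := fun p => hbdd p.1 p.2
  have hF' : ∀ p, -C ≤ Function.uncurry F p := fun p => (abs_le.1 (hF p)).1
  have hlip : ∀ n : ℕ, LipschitzWith n (lipschitzEnvelope (Function.uncurry F) n) := fun n =>
    mod_cast lipschitzWith_lipschitzEnvelope hF' n
  have hG : ∀ (n : ℕ) t x, |lipschitzEnvelope (Function.uncurry F) n (t, x)| ≤ C := fun n t x =>
    abs_lipschitzEnvelope_le hF n.cast_nonneg _
  obtain ⟨E, e, hE₀, hE, he⟩ := exists_tendsto_solution_of_monotone (K := fun n => n)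
    (G := fun n t x => lipschitzEnvelope (Function.uncurry F) n (t, x))
    (fun n => (hlip n).continuous)
    (fun n t => mul_one (n : NNReal) ▸ (hlip n).comp (LipschitzWith.prodMk_left t)) hG
    (fun m n hmn t x => lipschitzEnvelope_mono hF' m.cast_nonneg (mod_cast hmn) (t, x)) t₀ x₀
  have heq : ∀ t, t₀ ≤ t → e t = x₀ + ∫ s in t₀..t, F s (e s) := fun t ht =>
    eq_integral_of_tendsto_solution
      (G := fun n t x => lipschitzEnvelope (Function.uncurry F) n (t, x))
      (fun n => (hlip n).continuous) hG hE₀ hE he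
      (fun s hs => tendsto_lipschitzEnvelope hF' hcont.continuousAt
        (tendsto_const_nhds.prodMk_nhds (he s hs))) ht
  have hcontE : Continuous fun t => F t (e (max t t₀)) := by
    have hlip := lipschitzOnWith_of_tendsto_solution
      (C := ⟨C, (abs_nonneg _).trans (hbdd 0 0)⟩) hG hE he
    exact hcont.comp (continuous_id.prodMk
      (hlip.continuousOn.comp_continuous (by fun_prop) fun t => le_max_right t t₀))
  have hext : ∀ t, t₀ ≤ t → x₀ + ∫ s in t₀..t, F s (e (max s t₀)) = e t := fun t ht => by
    rw [heq t ht, intervalIntegral.integral_congr fun s hs => by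
      rw [max_eq_left (uIcc_of_le ht ▸ hs).1]]
  refine ⟨fun t => x₀ + ∫ s in t₀..t, F s (e (max s t₀)), by simp, fun t => ?_⟩
  beta_reduce
  rw [hext _ (le_max_right t t₀)]
  exact (intervalIntegral.integral_hasDerivAt_right (hcontE.intervalIntegrable _ _)
    hcontE.aestronglyMeasurable.stronglyMeasurableAtFilter hcontE.continuousAt).const_add x₀

theorem exists_solution_of_eq_zero_left (hcont : Continuous (Function.uncurry F))
    (hbdd : ∀ t x, |F t x| ≤ C) {x₀ : ℝ} (hzero : ∀ t ≤ t₀, F t x₀ = 0) :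
    ∃ E : ℝ → ℝ, (∀ t ≤ t₀, E t = x₀) ∧ ∀ t, HasDerivAt E (F t (E t)) t := by
  obtain ⟨E, hE₀, hE⟩ := exists_forward_solution hcont hbdd t₀ x₀
  have hconst : ∀ t ≤ t₀, E t = x₀ := by
    intro t ht
    have hderiv : ∀ s ≤ t₀, HasDerivAt E 0 s := fun s hs => by
      simpa only [max_eq_right hs, hE₀, hzero s hs] using hE s
    have := constant_of_has_deriv_right_zero
      (fun s hs => (hderiv s hs.2).continuousAt.continuousWithinAt)
      (fun s hs => (hderiv s hs.2.le).hasDerivWithinAt) t₀ (right_mem_Icc.2 ht)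
    exact this.symm.trans hE₀
  refine ⟨E, hconst, fun t => ?_⟩
  rcases le_total t t₀ with ht | ht
  · simpa only [max_eq_right ht, hE₀, hconst t ht] using hE t
  · simpa only [max_eq_left ht] using hE t

theorem exists_solution_mem_Icc (hcont : Continuous (Function.uncurry F)) {a b : ℝ} (hab : a ≤ b)
    (hbdd : ∀ t, ∀ x ∈ Icc a b, |F t x| ≤ C) (hzero : ∀ t ≤ t₀, F t a = 0)
    (hleft : ∀ t, t₀ < t → 0 ≤ F t a) (hright : ∀ t, t₀ < t → F t b ≤ 0) :
    ∃ E : ℝ → ℝ, (∀ t ≤ t₀, E t = a) ∧ (∀ t, E t ∈ Icc a b) ∧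
      ∀ t, HasDerivAt E (F t (E t)) t := by
  obtain ⟨E, hE₀, hE⟩ := exists_solution_of_eq_zero_left (C := C) (x₀ := a) (t₀ := t₀)
    (F := fun t x => F t (projIcc a b hab x))
    (hcont.comp (by fun_prop : Continuous fun p : ℝ × ℝ => (p.1, (projIcc a b hab p.2 : ℝ))))
    (fun t x => hbdd t _ (projIcc a b hab x).2) (fun t ht => by simpa using hzero t ht)
  have hcontE : Continuous E := continuous_iff_continuousAt.2 fun t => (hE t).continuousAt
  have hmem : ∀ t, E t ∈ Icc a b := fun t => by
    rcases le_total t t₀ with ht | ht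
    · rw [hE₀ t ht]
      exact left_mem_Icc.2 hab
    constructor
    · refine neg_le_neg_iff.1 (le_barrier_of_deriv_nonpos (u := fun _ => -a)
        hcontE.neg.continuousOn continuousOn_const monotoneOn_const (fun x _ => (hE x).neg)
        (by rw [Pi.neg_apply, hE₀ _ le_rfl]) (fun x hx hlt => ?_) t ⟨ht, le_rfl⟩)
      rw [projIcc_of_le_left hab (neg_lt_neg_iff.1 hlt).le]
      exact neg_nonpos.2 (hleft x hx.1)
    · refine le_barrier_of_deriv_nonpos (u := fun _ => b) hcontE.continuousOn continuousOn_const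
        monotoneOn_const (fun x _ => hE x) ((hE₀ _ le_rfl).trans_le hab) (fun x hx hlt => ?_) t
        ⟨ht, le_rfl⟩
      rw [projIcc_of_right_le hab hlt.le]
      exact hright x hx.1
  exact ⟨E, hE₀, hmem, fun t => by simpa only [projIcc_of_mem hab (hmem t)] using hE t⟩

/-- `√u` decreases at a rate of at least `k / 2`. -/
theorem exists_eq_zero_of_deriv_le_neg_sqrt {u u' : ℝ → ℝ} {a k : ℝ} (hk : 0 < k)
    (hu : ∀ t, a ≤ t → HasDerivAt u (u' t) t) (hnonneg : ∀ t, a ≤ t → 0 ≤ u t)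
    (hu' : ∀ t, a ≤ t → u' t ≤ -k * √(u t)) : ∃ t, a ≤ t ∧ u t = 0 := by
  by_contra! hne
  have hpos : ∀ t, a ≤ t → 0 < u t := fun t ht => (hnonneg t ht).lt_of_ne' (hne t ht)
  have hanti : AntitoneOn (fun t => √(u t) + k / 2 * t) (Ici a) := by
    refine antitoneOn_of_hasDerivWithinAt_nonpos (convex_Ici a)
      (f' := fun t => u' t / (2 * √(u t)) + k / 2) (fun t ht => ?_) (fun t ht => ?_)
      (fun t ht => ?_)
    · exact ((hu t ht).continuousAt.sqrt.add (by fun_prop)).continuousWithinAt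
    · rw [interior_Ici] at ht
      exact (((hu t ht.le).sqrt (hpos t ht.le).ne').add
        (hasDerivAt_const_mul (k / 2))).hasDerivWithinAt
    · rw [interior_Ici] at ht
      have hsqrt := Real.sqrt_pos.2 (hpos t ht.le)
      have : u' t / (2 * √(u t)) ≤ -k / 2 := by
        rw [div_le_iff₀ (by positivity)]
        linarith [hu' t ht.le]
      linarith
  set t := a + 2 * √(u a) / k with ht
  have hat : a ≤ t := le_add_of_nonneg_right (by positivity)
  have hle := hanti self_mem_Ici hat hat
  have : k / 2 * t = k / 2 * a + √(u a) := by rw [ht]; field_simp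
  linarith [Real.sqrt_pos.2 (hpos t hat)]

end ODE

namespace Market

variable {M : Market}

theorem Standing.gap_pos (hM : M.Standing) : 0 < M.g - M.s := sub_pos.2 hM.s_lt_g

theorem Standing.g_pos (hM : M.Standing) : 0 < M.g := hM.s_pos.trans hM.s_lt_g

theorem Standing.cbar_pos (hM : M.Standing) : 0 < M.cbar :=
  lt_trans (mul_pos (add_pos (div_pos hM.lam_pos hM.r_pos) one_pos) hM.gap_pos) hM.cbar_large

/-! ### The distribution function -/

@[simp] theorem H_zero (M : Market) : M.H 0 = 0 := by simp [H]

theorem Standing.h_intervalIntegrable (hM : M.Standing) {x y : ℝ} (hx : x ∈ Icc 0 M.cbar)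
    (hy : y ∈ Icc 0 M.cbar) : IntervalIntegrable M.h volume x y :=
  (hM.h_continuous.mono (uIcc_subset_Icc hx hy)).intervalIntegrable

theorem Standing.H_strictMonoOn (hM : M.Standing) : StrictMonoOn M.H (Icc 0 M.cbar) := by
  intro x hx y hy hxy
  have h0 : (0 : ℝ) ∈ Icc 0 M.cbar := ⟨le_rfl, hM.cbar_pos.le⟩
  have h1 := intervalIntegral.integral_add_adjacent_intervals
    (hM.h_intervalIntegrable h0 hx) (hM.h_intervalIntegrable hx hy)
  have h2 : 0 < ∫ t in x..y, M.h t :=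
    intervalIntegral.intervalIntegral_pos_of_pos_on (hM.h_intervalIntegrable hx hy)
      (fun t ht => hM.h_pos t ⟨hx.1.trans ht.1.le, ht.2.le.trans hy.2⟩) hxy
  unfold H
  linarith

theorem Standing.H_continuousOn (hM : M.Standing) : ContinuousOn M.H (Icc 0 M.cbar) :=
  intervalIntegral.continuousOn_primitive_interval
    (hM.h_continuous.mono (by rw [uIcc_of_le hM.cbar_pos.le])).integrableOn_uIcc |>.mono
      (by rw [uIcc_of_le hM.cbar_pos.le])

theorem Standing.H_hasDerivAt (hM : M.Standing) {x : ℝ} (hx : x ∈ Ioo 0 M.cbar) :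
    HasDerivAt M.H (M.h x) x := by
  have hn : Icc 0 M.cbar ∈ 𝓝 x := Icc_mem_nhds hx.1 hx.2
  exact intervalIntegral.integral_hasDerivAt_right
    (hM.h_intervalIntegrable ⟨le_rfl, hM.cbar_pos.le⟩ (Ioo_subset_Icc_self hx))
    (hM.h_continuous.stronglyMeasurableAtFilter_nhdsWithin measurableSet_Icc x |>.filter_mono
      (by rw [nhdsWithin_eq_nhds.2 hn]))
    (hM.h_continuous.continuousAt hn)

theorem Standing.H_nonneg (hM : M.Standing) {b : ℝ} (hb : b ∈ Icc 0 M.cbar) : 0 ≤ M.H b := by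
  simpa using hM.H_strictMonoOn.monotoneOn ⟨le_rfl, hM.cbar_pos.le⟩ hb hb.1

theorem Standing.H_pos (hM : M.Standing) {b : ℝ} (hb : b ∈ Icc 0 M.cbar) (h : 0 < b) :
    0 < M.H b := by
  simpa using hM.H_strictMonoOn ⟨le_rfl, hM.cbar_pos.le⟩ hb h

theorem Standing.H_le_one (hM : M.Standing) {b : ℝ} (hb : b ∈ Icc 0 M.cbar) : M.H b ≤ 1 := by
  simpa [hM.h_total] using hM.H_strictMonoOn.monotoneOn hb ⟨hM.cbar_pos.le, le_rfl⟩ hb.2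

theorem Standing.H_lt_one (hM : M.Standing) {b : ℝ} (hb : b ∈ Icc 0 M.cbar) (h : b < M.cbar) :
    M.H b < 1 := by
  simpa [hM.h_total] using hM.H_strictMonoOn hb ⟨hM.cbar_pos.le, le_rfl⟩ h

theorem Standing.exists_H_le_mul (hM : M.Standing) :
    ∃ C, 0 < C ∧ ∀ b ∈ Icc 0 M.cbar, M.H b ≤ C * b := by
  obtain ⟨C, hC⟩ := isCompact_Icc.exists_bound_of_continuousOn hM.h_continuous
  have h0 : (0 : ℝ) ∈ Icc 0 M.cbar := ⟨le_rfl, hM.cbar_pos.le⟩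
  refine ⟨C, (norm_pos_iff.2 (hM.h_pos 0 h0).ne').trans_le (hC 0 h0), fun b hb => ?_⟩
  have := intervalIntegral.norm_integral_le_of_norm_le_const (a := 0) (b := b) (f := M.h) (C := C)
    fun x hx => hC x (by rw [uIoc_of_le hb.1] at hx; exact ⟨hx.1.le, hx.2.trans hb.2⟩)
  rw [sub_zero, abs_of_nonneg hb.1] at this
  exact (le_abs_self _).trans this

/-! ### The value of a report -/

/-- A bonus maximizing `H b * (y - b)`, the net gain of a seller who values reports at `y`. -/
noncomputable def bestBonus (M : Market) (y : ℝ) : ℝ :=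
  Classical.epsilon fun b => b ∈ Icc 0 M.cbar ∧ IsMaxOn (fun b => M.H b * (y - b)) (Icc 0 M.cbar) b

/-- The maximal net gain of a seller who values reports at `y`. -/
noncomputable def phi (M : Market) (y : ℝ) : ℝ := M.H (M.bestBonus y) * (y - M.bestBonus y)

theorem Standing.bestBonus_spec (hM : M.Standing) (y : ℝ) : M.bestBonus y ∈ Icc 0 M.cbar ∧
    ∀ b ∈ Icc 0 M.cbar, M.H b * (y - b) ≤ M.phi y := by
  have hspec := Classical.epsilon_spec (isCompact_Icc.exists_isMaxOn
    ⟨0, le_rfl, hM.cbar_pos.le⟩ (hM.H_continuousOn.mul (f := M.H) (g := fun b => y - b)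
      (by fun_prop)))
  exact ⟨hspec.1, fun b hb => hspec.2 hb⟩

theorem Standing.bestBonus_mem (hM : M.Standing) (y : ℝ) : M.bestBonus y ∈ Icc 0 M.cbar :=
  (hM.bestBonus_spec y).1

theorem Standing.le_phi (hM : M.Standing) (y : ℝ) {b : ℝ} (hb : b ∈ Icc 0 M.cbar) :
    M.H b * (y - b) ≤ M.phi y :=
  (hM.bestBonus_spec y).2 b hb

theorem Standing.phi_nonneg (hM : M.Standing) (y : ℝ) : 0 ≤ M.phi y := by
  simpa using hM.le_phi y ⟨le_rfl, hM.cbar_pos.le⟩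

theorem Standing.phi_pos (hM : M.Standing) {y : ℝ} (hy : 0 < y) : 0 < M.phi y := by
  have hm : 0 < min (y / 2) M.cbar := lt_min (half_pos hy) hM.cbar_pos
  have hb : min (y / 2) M.cbar ∈ Icc 0 M.cbar := ⟨hm.le, min_le_right _ _⟩
  refine lt_of_lt_of_le (mul_pos (hM.H_pos hb hm) ?_) (hM.le_phi y hb)
  linarith [min_le_left (y / 2) M.cbar]

theorem Standing.eq_zero_of_eq_phi (hM : M.Standing) {y b : ℝ} (hy : y ≤ 0)
    (hb : b ∈ Icc 0 M.cbar) (h : M.H b * (y - b) = M.phi y) : b = 0 := by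
  by_contra hne
  have hpos : 0 < b := lt_of_le_of_ne hb.1 (Ne.symm hne)
  have := mul_neg_of_pos_of_neg (hM.H_pos hb hpos) (show y - b < 0 by linarith)
  linarith [hM.phi_nonneg y]

theorem Standing.pos_of_eq_phi (hM : M.Standing) {y b : ℝ} (hy : 0 < y)
    (hb : b ∈ Icc 0 M.cbar) (h : M.H b * (y - b) = M.phi y) : 0 < b ∧ b < y := by
  have hφ := hM.phi_pos hy
  have hgain : 0 < y - b := pos_of_mul_pos_right (h ▸ hφ) (hM.H_nonneg hb)
  refine ⟨hb.1.lt_of_ne ?_, sub_pos.1 hgain⟩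
  rintro rfl
  rw [H_zero, zero_mul] at h
  exact hφ.ne h

theorem Standing.bestBonus_of_nonpos (hM : M.Standing) {y : ℝ} (hy : y ≤ 0) :
    M.bestBonus y = 0 :=
  hM.eq_zero_of_eq_phi hy (hM.bestBonus_mem y) rfl

theorem Standing.phi_of_nonpos (hM : M.Standing) {y : ℝ} (hy : y ≤ 0) : M.phi y = 0 := by
  simp [phi, hM.bestBonus_of_nonpos hy]

theorem Standing.mul_sub_le_phi_sub (hM : M.Standing) (x y : ℝ) :
    M.H (M.bestBonus x) * (y - x) ≤ M.phi y - M.phi x := by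
  have := hM.le_phi y (hM.bestBonus_mem x)
  have h2 : M.phi x = M.H (M.bestBonus x) * (x - M.bestBonus x) := rfl
  linear_combination this + h2

theorem Standing.phi_strictMonoOn (hM : M.Standing) : StrictMonoOn M.phi (Ici 0) := by
  intro x hx y _ hxy
  rcases eq_or_lt_of_le (show (0 : ℝ) ≤ x from hx) with rfl | hx0
  · rw [hM.phi_of_nonpos le_rfl]
    exact hM.phi_pos hxy
  · have h1 := hM.mul_sub_le_phi_sub x y
    have h2 := mul_pos (hM.H_pos (hM.bestBonus_mem x)
      (hM.pos_of_eq_phi hx0 (hM.bestBonus_mem x) rfl).1) (sub_pos.2 hxy)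
    linarith

theorem Standing.phi_sub_le (hM : M.Standing) {x y : ℝ} (hxy : x ≤ y) :
    M.phi y - M.phi x ≤ y - x := by
  have h1 := hM.mul_sub_le_phi_sub y x
  have h2 := mul_le_of_le_one_left (sub_nonneg.2 hxy) (hM.H_le_one (hM.bestBonus_mem y))
  linarith

theorem Standing.phi_mono (hM : M.Standing) : Monotone M.phi := by
  intro x y hxy
  have h1 := hM.mul_sub_le_phi_sub x y
  have h2 := mul_nonneg (hM.H_nonneg (hM.bestBonus_mem x)) (sub_nonneg.2 hxy)
  linarith

theorem Standing.phi_continuous (hM : M.Standing) : Continuous M.phi := by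
  refine (LipschitzWith.of_le_add_mul 1 fun x y => ?_).continuous
  rcases le_total x y with h | h
  · have := hM.phi_mono h
    simp only [NNReal.coe_one, one_mul]
    linarith [dist_nonneg (x := x) (y := y)]
  · have := hM.phi_sub_le h
    simp only [NNReal.coe_one, one_mul, Real.dist_eq]
    linarith [le_abs_self (x - y)]

theorem Standing.exists_phi_le_sq (hM : M.Standing) :
    ∃ C, 0 < C ∧ ∀ y, 0 ≤ y → M.phi y ≤ C * y ^ 2 := by
  obtain ⟨C, hC, h⟩ := hM.exists_H_le_mul
  refine ⟨C, hC, fun y hy => ?_⟩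
  rcases eq_or_lt_of_le hy with rfl | hy0
  · simp [hM.phi_of_nonpos le_rfl]
  · have hb := hM.bestBonus_mem y
    obtain ⟨h1, h2⟩ := hM.pos_of_eq_phi hy0 hb rfl
    calc M.phi y ≤ (C * M.bestBonus y) * y :=
          mul_le_mul (h _ hb) (by linarith) (by linarith) (mul_nonneg hC.le h1.le)
      _ ≤ (C * y) * y := by gcongr
      _ = C * y ^ 2 := by ring

theorem Standing.bestBonus_monotone (hM : M.Standing) : Monotone M.bestBonus := by
  intro x y hxy
  rcases eq_or_lt_of_le hxy with rfl | hlt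
  · exact le_rfl
  have h1 := hM.mul_sub_le_phi_sub x y
  have h2 := hM.mul_sub_le_phi_sub y x
  have h3 : M.H (M.bestBonus x) ≤ M.H (M.bestBonus y) := by
    by_contra! h
    nlinarith [sub_pos.2 hlt]
  exact (hM.H_strictMonoOn.le_iff_le (hM.bestBonus_mem x) (hM.bestBonus_mem y)).1 h3

theorem Standing.beta_strictMonoOn (hM : M.Standing) : StrictMonoOn M.beta (Ioo 0 M.cbar) :=
  strictMonoOn_of_deriv_pos (convex_Ioo _ _) hM.beta_contDiff.continuousOn
    (by simpa using hM.beta_deriv_pos)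

theorem Standing.beta_bestBonus (hM : M.Standing) {y : ℝ} (hy : y ∈ Ioo 0 M.cbar) :
    M.bestBonus y ∈ Ioo 0 M.cbar ∧ M.beta (M.bestBonus y) = y := by
  obtain ⟨h1, h2⟩ := hM.pos_of_eq_phi hy.1 (hM.bestBonus_mem y) rfl
  have hmem : M.bestBonus y ∈ Ioo 0 M.cbar := ⟨h1, h2.trans hy.2⟩
  refine ⟨hmem, ?_⟩
  have hmax : IsLocalMax (fun b => M.H b * (y - b)) (M.bestBonus y) := by
    filter_upwards [Icc_mem_nhds hmem.1 hmem.2] with b hb using hM.le_phi y hb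
  have hd : HasDerivAt (fun b => M.H b * (y - b))
      (M.h (M.bestBonus y) * (y - M.bestBonus y) + M.H (M.bestBonus y) * (-1)) (M.bestBonus y) :=
    (hM.H_hasDerivAt hmem).mul ((hasDerivAt_id _).const_sub y)
  have h0 := hmax.hasDerivAt_eq_zero hd
  have hh := hM.h_pos _ (Ioo_subset_Icc_self hmem)
  unfold beta
  field_simp
  linarith

theorem Standing.bestBonus_continuousAt (hM : M.Standing) {y : ℝ} (hy : y < M.cbar) :
    ContinuousAt M.bestBonus y := by
  rcases le_or_gt y 0 with h0 | h0
  · rw [ContinuousAt, hM.bestBonus_of_nonpos h0]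
    refine tendsto_order.2 ⟨fun a ha => Eventually.of_forall fun x =>
      ha.trans_le (hM.bestBonus_mem x).1, fun a ha => ?_⟩
    filter_upwards [gt_mem_nhds (h0.trans_lt ha)] with x hx
    rcases le_or_gt x 0 with hx0 | hx0
    · rwa [hM.bestBonus_of_nonpos hx0]
    · exact (hM.pos_of_eq_phi hx0 (hM.bestBonus_mem x) rfl).2.trans hx
  · obtain ⟨hb, hβ⟩ := hM.beta_bestBonus ⟨h0, hy⟩
    refine continuousAt_of_monotoneOn_of_image_mem_nhds (s := Ioo 0 M.cbar)
      (hM.bestBonus_monotone.monotoneOn _) (Ioo_mem_nhds h0 hy) ?_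
    have hc : ContinuousAt M.beta (M.bestBonus y) :=
      hM.beta_contDiff.continuousOn.continuousAt (Ioo_mem_nhds hb.1 hb.2)
    filter_upwards [hc.preimage_mem_nhds (Ioo_mem_nhds (hβ.symm ▸ h0) (hβ.symm ▸ hy)),
      Ioo_mem_nhds hb.1 hb.2] with b hb1 hb2
    obtain ⟨h3, h4⟩ := hM.beta_bestBonus hb1
    exact ⟨M.beta b, hb1, hM.beta_strictMonoOn.injOn h3 hb2 h4⟩

/-! ### The report value that yields a given net gain -/

theorem Standing.phi_add_min_strictMono (hM : M.Standing) :
    StrictMono fun y => M.phi y + min y 0 := by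
  refine StrictMonoOn.Iic_union_Ici (a := 0) (fun x hx y hy hxy => ?_) fun x hx y hy hxy => ?_
  · simpa only [hM.phi_of_nonpos hx, hM.phi_of_nonpos hy, min_eq_left (mem_Iic.1 hx),
      min_eq_left (mem_Iic.1 hy), zero_add] using hxy
  · simpa only [min_eq_right (mem_Ici.1 hx), min_eq_right (mem_Ici.1 hy), add_zero]
      using hM.phi_strictMonoOn hx hy hxy

theorem Standing.phi_add_min_surjective (hM : M.Standing) :
    Function.Surjective fun y => M.phi y + min y 0 := by
  refine Continuous.surjective (hM.phi_continuous.add (by fun_prop)) ?_ ?_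
  · refine tendsto_atTop_mono (fun y => ?_) (tendsto_atTop_add_const_right _ (-M.cbar) tendsto_id)
    have := hM.le_phi y ⟨hM.cbar_pos.le, le_rfl⟩
    rw [hM.h_total] at this
    rcases le_total y 0 with hy | hy
    · simp only [hM.phi_of_nonpos hy, min_eq_left hy, id_eq]
      linarith [hM.cbar_pos]
    · simp only [min_eq_right hy, id_eq]
      linarith
  · refine tendsto_id.congr' ?_
    filter_upwards [eventually_le_atBot 0] with y hy
    simp [hM.phi_of_nonpos hy, min_eq_left hy]

/-- The report value at which the maximal net gain is `u`. For `u < 0`, where there is none, it is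
`u` itself, which makes it an order isomorphism, hence continuous. -/
noncomputable def Standing.invPhi (hM : M.Standing) : ℝ ≃o ℝ :=
  (hM.phi_add_min_strictMono.orderIsoOfSurjective _ hM.phi_add_min_surjective).symm

theorem Standing.invPhi_eq_iff (hM : M.Standing) {u y : ℝ} :
    hM.invPhi u = y ↔ u = M.phi y + min y 0 :=
  OrderIso.symm_apply_eq _

theorem Standing.invPhi_of_nonpos (hM : M.Standing) {u : ℝ} (hu : u ≤ 0) : hM.invPhi u = u :=
  hM.invPhi_eq_iff.2 (by rw [hM.phi_of_nonpos hu, min_eq_left hu, zero_add])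

theorem Standing.invPhi_phi (hM : M.Standing) {y : ℝ} (hy : 0 ≤ y) : hM.invPhi (M.phi y) = y :=
  hM.invPhi_eq_iff.2 (by rw [min_eq_right hy, add_zero])

theorem Standing.invPhi_nonneg (hM : M.Standing) {u : ℝ} (hu : 0 ≤ u) : 0 ≤ hM.invPhi u := by
  simpa only [hM.invPhi_of_nonpos le_rfl] using hM.invPhi.monotone hu

theorem Standing.invPhi_pos_iff (hM : M.Standing) {u : ℝ} : 0 < hM.invPhi u ↔ 0 < u := by
  simpa only [hM.invPhi_of_nonpos le_rfl] using hM.invPhi.lt_iff_lt (x := 0) (y := u)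

theorem Standing.phi_invPhi (hM : M.Standing) {u : ℝ} (hu : 0 ≤ u) :
    M.phi (hM.invPhi u) = u := by
  have h := hM.invPhi_eq_iff.1 (rfl : hM.invPhi u = _)
  rwa [min_eq_right (hM.invPhi_nonneg hu), add_zero, eq_comm] at h

theorem Standing.exists_sqrt_le_invPhi (hM : M.Standing) :
    ∃ C, 0 < C ∧ ∀ u, 0 ≤ u → √u ≤ C * hM.invPhi u := by
  obtain ⟨C, hC, h⟩ := hM.exists_phi_le_sq
  refine ⟨√C, Real.sqrt_pos.2 hC, fun u hu => ?_⟩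
  have hy := hM.invPhi_nonneg hu
  calc √u ≤ √(C * hM.invPhi u ^ 2) :=
        Real.sqrt_le_sqrt ((hM.phi_invPhi hu).symm.trans_le (h _ hy))
    _ = √C * hM.invPhi u := by rw [Real.sqrt_mul hC.le, Real.sqrt_sq hy]

end Market

/-- The log-odds of a belief, inverse to `Real.sigmoid`. Bayes' rule lowers it at the rate
`λ H(b)`, independent of the belief. -/
noncomputable def logOdds (α : ℝ) : ℝ := Real.log (α / (1 - α))

theorem sigmoid_logOdds {α : ℝ} (hα : α ∈ Ioo (0 : ℝ) 1) : Real.sigmoid (logOdds α) = α := by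
  have h0 := hα.1.ne'
  have h1 := sub_pos.2 hα.2
  rw [Real.sigmoid_def, logOdds, Real.exp_neg, Real.exp_log (div_pos hα.1 h1)]
  field_simp
  simp

theorem sigmoid_mem_Ioo (ξ : ℝ) : Real.sigmoid ξ ∈ Ioo (0 : ℝ) 1 :=
  ⟨Real.sigmoid_pos ξ, Real.sigmoid_lt_one ξ⟩

theorem logOdds_le_iff {α ξ : ℝ} (hα : α ∈ Ioo (0 : ℝ) 1) :
    logOdds α ≤ ξ ↔ α ≤ Real.sigmoid ξ := by
  rw [← Real.sigmoid_le_iff, sigmoid_logOdds hα]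

theorem hasDerivAt_logOdds {α : ℝ} (hα : α ∈ Ioo (0 : ℝ) 1) :
    HasDerivAt logOdds (α * (1 - α))⁻¹ α := by
  have h0 := hα.1.ne'
  have h1 := (sub_pos.2 hα.2).ne'
  refine (((hasDerivAt_id α).div ((hasDerivAt_id α).const_sub 1) h1).log
    (div_ne_zero h0 h1)).congr_deriv ?_
  simp only [id_eq, Pi.div_apply]
  field_simp
  ring

namespace Market

variable {M : Market}

/-- The belief at which experimentation starts. -/
noncomputable def cutSP (M : Market) : ℝ := M.s * M.r / (M.lam * (M.g - M.s) + M.r * M.g)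

/-- The belief at which the two arms yield the same flow profit. -/
noncomputable def cutPF (M : Market) : ℝ := M.s / M.g

/-- The value of a report to a sure seller who only earns the safe profit. -/
noncomputable def topValue (M : Market) : ℝ := M.lam * (M.g - M.s) / M.r

theorem Standing.cutSP_denom_pos (hM : M.Standing) : 0 < M.lam * (M.g - M.s) + M.r * M.g :=
  add_pos (mul_pos hM.lam_pos hM.gap_pos) (mul_pos hM.r_pos hM.g_pos)

theorem Standing.cutSP_pos (hM : M.Standing) : 0 < M.cutSP :=
  div_pos (mul_pos hM.s_pos hM.r_pos) hM.cutSP_denom_pos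

theorem Standing.cutSP_lt_cutPF (hM : M.Standing) : M.cutSP < M.cutPF := by
  unfold cutSP cutPF
  rw [div_lt_div_iff₀ hM.cutSP_denom_pos hM.g_pos]
  linarith [mul_pos hM.s_pos (mul_pos hM.lam_pos hM.gap_pos)]

theorem Standing.cutPF_lt_one (hM : M.Standing) : M.cutPF < 1 :=
  (div_lt_one hM.g_pos).2 hM.s_lt_g

theorem Standing.cutSP_mem (hM : M.Standing) : M.cutSP ∈ Ioo (0 : ℝ) 1 :=
  ⟨hM.cutSP_pos, hM.cutSP_lt_cutPF.trans hM.cutPF_lt_one⟩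

theorem Standing.cutPF_mem (hM : M.Standing) : M.cutPF ∈ Ioo (0 : ℝ) 1 :=
  ⟨hM.cutSP_pos.trans hM.cutSP_lt_cutPF, hM.cutPF_lt_one⟩

theorem Standing.g_mul_cutPF (hM : M.Standing) : M.g * M.cutPF = M.s :=
  mul_div_cancel₀ _ hM.g_pos.ne'

theorem Standing.lt_cutPF_iff (hM : M.Standing) {a : ℝ} : a < M.cutPF ↔ M.g * a < M.s := by
  rw [cutPF, lt_div_iff₀ hM.g_pos, mul_comm]

theorem Standing.cutPF_le_iff (hM : M.Standing) {a : ℝ} : M.cutPF ≤ a ↔ M.s ≤ M.g * a := by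
  rw [← not_lt, hM.lt_cutPF_iff, not_lt]

theorem Standing.safe_report_value (hM : M.Standing) (a : ℝ) :
    M.lam * a * (M.g / M.r - M.s / M.r) + (M.g * a - M.s) =
      (a - M.cutSP) * ((M.lam * (M.g - M.s) + M.r * M.g) / M.r) := by
  have h1 : M.cutSP * (M.lam * (M.g - M.s) + M.r * M.g) = M.s * M.r :=
    div_mul_cancel₀ _ hM.cutSP_denom_pos.ne'
  have h2 := hM.r_pos.ne'
  field_simp
  linear_combination h1

theorem Standing.topValue_pos (hM : M.Standing) : 0 < M.topValue :=
  div_pos (mul_pos hM.lam_pos hM.gap_pos) hM.r_pos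

theorem Standing.topValue_lt_cbar (hM : M.Standing) : M.topValue < M.cbar := by
  have h1 : (M.lam / M.r + 1) * (M.g - M.s) = M.topValue + (M.g - M.s) := by
    unfold topValue; ring
  linarith [hM.cbar_large, hM.gap_pos]

theorem Standing.safe_lt_risky (hM : M.Standing) : M.s / M.r < M.g / M.r :=
  div_lt_div_of_pos_right hM.s_lt_g hM.r_pos

/-! ### The differential equation of the value function -/

/-- The derivative with respect to the log-odds of a solution of the Bellman equation, at the
belief `a` and the value `x`: the Bellman equation `r x = max (g a) s + φ(y)` determines the report
value `y`, and with it the derivative. -/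
noncomputable def Standing.slope (hM : M.Standing) (a x : ℝ) : ℝ :=
  a * (M.g / M.r - x) +
    (M.g * a - max (M.g * a) M.s - hM.invPhi (M.r * x - max (M.g * a) M.s)) / M.lam

theorem Standing.slope_continuous (hM : M.Standing) :
    Continuous (Function.uncurry hM.slope) := by
  have := hM.invPhi.continuous
  unfold Standing.slope Function.uncurry
  fun_prop

theorem Standing.lam_mul_slope (hM : M.Standing) (a x : ℝ) :
    M.lam * hM.slope a x = M.lam * a * (M.g / M.r - x) +
      (M.g * a - max (M.g * a) M.s) - hM.invPhi (M.r * x - max (M.g * a) M.s) := by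
  rw [slope, mul_add, mul_div_cancel₀ _ hM.lam_pos.ne']
  ring

theorem Standing.lam_mul_slope_safe (hM : M.Standing) (a : ℝ) :
    M.lam * hM.slope a (M.s / M.r) =
      (a - M.cutSP) * ((M.lam * (M.g - M.s) + M.r * M.g) / M.r) := by
  rw [lam_mul_slope, mul_div_cancel₀ _ hM.r_pos.ne',
    hM.invPhi_of_nonpos (sub_nonpos.2 (le_max_right _ _)), ← hM.safe_report_value]
  ring

theorem Standing.slope_safe_pos (hM : M.Standing) {a : ℝ} (ha : M.cutSP < a) :
    0 < hM.slope a (M.s / M.r) := by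
  refine pos_of_mul_pos_right (a := M.lam) ?_ hM.lam_pos.le
  rw [lam_mul_slope_safe]
  exact mul_pos (sub_pos.2 ha) (div_pos hM.cutSP_denom_pos hM.r_pos)

theorem Standing.slope_cutSP_safe (hM : M.Standing) : hM.slope M.cutSP (M.s / M.r) = 0 := by
  refine (mul_eq_zero.1 ?_).resolve_left hM.lam_pos.ne'
  rw [lam_mul_slope_safe, sub_self, zero_mul]

theorem Standing.slope_risky_nonpos (hM : M.Standing) {a : ℝ} (ha : a ≤ 1) :
    hM.slope a (M.g / M.r) ≤ 0 := by
  have hgain : 0 ≤ hM.invPhi (M.r * (M.g / M.r) - max (M.g * a) M.s) := by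
    rw [mul_div_cancel₀ _ hM.r_pos.ne']
    exact hM.invPhi_nonneg (sub_nonneg.2
      (max_le (mul_le_of_le_one_right hM.g_pos.le ha) hM.s_lt_g.le))
  rw [slope, sub_self, mul_zero, zero_add]
  exact div_nonpos_of_nonpos_of_nonneg (by linarith [le_max_left (M.g * a) M.s])
    hM.lam_pos.le

theorem Standing.le_slope (hM : M.Standing) {a x : ℝ} (ha₀ : 0 ≤ a) (ha : M.cutPF ≤ a)
    (hx : M.r * x ≤ M.g * a) : M.g * (a * (1 - a)) ≤ M.r * hM.slope a x := by
  have hs := hM.cutPF_le_iff.1 ha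
  have hloss : hM.invPhi (M.r * x - max (M.g * a) M.s) ≤ 0 := by
    have hu : M.r * x - max (M.g * a) M.s ≤ 0 := by linarith [le_max_left (M.g * a) M.s]
    rwa [hM.invPhi_of_nonpos hu]
  rw [slope, mul_add]
  have h1 : M.r * (a * (M.g / M.r - x)) = a * (M.g - M.r * x) := by
    have := hM.r_pos.ne'
    field_simp
  have h2 : 0 ≤ M.g * a - max (M.g * a) M.s - hM.invPhi (M.r * x - max (M.g * a) M.s) := by
    linarith [max_le le_rfl hs]
  have h3 := mul_nonneg hM.r_pos.le (div_nonneg h2 hM.lam_pos.le)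
  linarith [mul_le_mul_of_nonneg_left hx ha₀]

theorem Standing.slope_nonpos (hM : M.Standing) {a x : ℝ} (ha : a ∈ Icc (0 : ℝ) 1)
    (hx : M.s / M.r ≤ x) (hgain : max (M.g * a) M.s + M.phi M.topValue ≤ M.r * x) :
    hM.slope a x ≤ 0 := by
  have htop : M.topValue ≤ hM.invPhi (M.r * x - max (M.g * a) M.s) := by
    rw [← hM.invPhi_phi hM.topValue_pos.le]
    exact hM.invPhi.monotone (by linarith)
  have hgap : M.lam * a * (M.g / M.r - x) ≤ M.topValue := by
    calc M.lam * a * (M.g / M.r - x) ≤ M.lam * a * (M.g / M.r - M.s / M.r) := by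
          have := hM.lam_pos
          have := ha.1
          gcongr
      _ = M.topValue * a := by unfold topValue; ring
      _ ≤ M.topValue := mul_le_of_le_one_right hM.topValue_pos.le ha.2
  refine nonpos_of_mul_nonpos_right (a := M.lam) ?_ hM.lam_pos
  rw [lam_mul_slope]
  linarith [le_max_left (M.g * a) M.s]

theorem Standing.exists_abs_slope_le (hM : M.Standing) :
    ∃ C, ∀ a ∈ Icc (0 : ℝ) 1, ∀ x ∈ Icc (M.s / M.r) (M.g / M.r), |hM.slope a x| ≤ C := by
  obtain ⟨C, hC⟩ := (isCompact_Icc.prod isCompact_Icc).exists_bound_of_continuousOn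
    (s := Icc (0 : ℝ) 1 ×ˢ Icc (M.s / M.r) (M.g / M.r)) hM.slope_continuous.continuousOn
  exact ⟨C, fun a ha x hx => hC (a, x) ⟨ha, hx⟩⟩

/-- A solution of the differential equation of the value function in the log-odds `ξ` of the
belief. It is a global solution on the line, frozen at the safe value up to `cutSP`. -/
structure IsLogOddsSolution (hM : M.Standing) (V : ℝ → ℝ) : Prop where
  eq_safe : ∀ ξ ≤ logOdds M.cutSP, V ξ = M.s / M.r
  mem : ∀ ξ, V ξ ∈ Icc (M.s / M.r) (M.g / M.r)
  hasDerivAt_max : ∀ ξ, HasDerivAt V (hM.slope (max M.cutSP (Real.sigmoid ξ)) (V ξ)) ξ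

/-- The log-odds above `cutPF` at which the value is that of selling the risky product forever. -/
def riskySet (M : Market) (V : ℝ → ℝ) : Set ℝ :=
  {ξ | logOdds M.cutPF ≤ ξ ∧ M.r * V ξ - M.g * Real.sigmoid ξ = 0}

theorem Standing.exists_isLogOddsSolution (hM : M.Standing) :
    ∃ V, IsLogOddsSolution hM V := by
  obtain ⟨C, hC⟩ := hM.exists_abs_slope_le
  have hbelief : ∀ ξ, max M.cutSP (Real.sigmoid ξ) ∈ Icc (0 : ℝ) 1 := fun ξ =>
    ⟨le_max_of_le_right (sigmoid_mem_Ioo ξ).1.le, max_le hM.cutSP_mem.2.le (sigmoid_mem_Ioo ξ).2.le⟩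
  obtain ⟨V, hV₀, hV, hderiv⟩ := exists_solution_mem_Icc (C := C) (t₀ := logOdds M.cutSP)
    (F := fun ξ x => hM.slope (max M.cutSP (Real.sigmoid ξ)) x)
    (hM.slope_continuous.comp (by fun_prop : Continuous fun p : ℝ × ℝ =>
      (max M.cutSP (Real.sigmoid p.1), p.2)))
    hM.safe_lt_risky.le (fun ξ => hC _ (hbelief ξ))
    (fun ξ hξ => by
      rw [← Real.sigmoid_le_iff, sigmoid_logOdds hM.cutSP_mem] at hξ
      rw [max_eq_left hξ, hM.slope_cutSP_safe])
    (fun ξ hξ => by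
      rw [← Real.sigmoid_lt_iff, sigmoid_logOdds hM.cutSP_mem] at hξ
      rw [max_eq_right hξ.le]
      exact (hM.slope_safe_pos hξ).le)
    (fun ξ _ => hM.slope_risky_nonpos (hbelief ξ).2)
  exact ⟨V, hV₀, hV, hderiv⟩

namespace IsLogOddsSolution

variable {hM : M.Standing} {V : ℝ → ℝ}

theorem continuous (hV : IsLogOddsSolution hM V) : Continuous V :=
  continuous_iff_continuousAt.2 fun ξ => (hV.hasDerivAt_max ξ).continuousAt

theorem hasDerivAt (hV : IsLogOddsSolution hM V) {ξ : ℝ} (hξ : M.cutSP ≤ Real.sigmoid ξ) :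
    HasDerivAt V (hM.slope (Real.sigmoid ξ) (V ξ)) ξ := by
  simpa only [max_eq_right hξ] using hV.hasDerivAt_max ξ

theorem safe_lt (hV : IsLogOddsSolution hM V) {ξ : ℝ} (hξ : M.cutSP < Real.sigmoid ξ) :
    M.s / M.r < V ξ := by
  refine (hV.mem ξ).1.lt_of_ne' fun heq => ?_
  have hmin : IsLocalMin V ξ := Eventually.of_forall fun x => heq.trans_le (hV.mem x).1
  have hzero := hmin.hasDerivAt_eq_zero (hV.hasDerivAt hξ.le)
  rw [heq] at hzero
  exact (hM.slope_safe_pos hξ).ne' hzero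

theorem safe_le (hV : IsLogOddsSolution hM V) (ξ : ℝ) : M.s ≤ M.r * V ξ := by
  have := (hV.mem ξ).1
  rwa [div_le_iff₀' hM.r_pos] at this

theorem le_sigmoid_of_mem_Ioo {α ξ x : ℝ} (hα : α ∈ Ioo (0 : ℝ) 1) (hx : x ∈ Ioo (logOdds α) ξ) :
    α ≤ Real.sigmoid x :=
  (logOdds_le_iff hα).1 hx.1.le

theorem flow_le (hV : IsLogOddsSolution hM V) (ξ : ℝ) :
    max (M.g * Real.sigmoid ξ) M.s ≤ M.r * V ξ := by
  refine max_le ?_ (hV.safe_le ξ)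
  rcases lt_or_ge (Real.sigmoid ξ) M.cutPF with hξ | hξ
  · exact (hM.lt_cutPF_iff.1 hξ).le.trans (hV.safe_le ξ)
  have hbelow : M.g * Real.sigmoid ξ - M.r * V ξ ≤ 0 := by
    refine le_barrier_of_deriv_nonpos (f := fun x => M.g * Real.sigmoid x - M.r * V x)
      (f' := fun x => M.g * (Real.sigmoid x * (1 - Real.sigmoid x)) -
        M.r * hM.slope (Real.sigmoid x) (V x)) (u := fun _ => 0) ?_
      continuousOn_const monotoneOn_const (fun x hx => ?_) ?_ (fun x hx hlt => ?_) ξ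
      ⟨(logOdds_le_iff hM.cutPF_mem).2 hξ, le_rfl⟩
    · have := hV.continuous
      exact Continuous.continuousOn (by fun_prop)
    · exact ((Real.hasDerivAt_sigmoid x).const_mul _).sub ((hV.hasDerivAt
        (hM.cutSP_lt_cutPF.le.trans (le_sigmoid_of_mem_Ioo hM.cutPF_mem hx))).const_mul _)
    · rw [sigmoid_logOdds hM.cutPF_mem, hM.g_mul_cutPF]
      exact sub_nonpos.2 (hV.safe_le _)
    · exact sub_nonpos.2 (hM.le_slope (sigmoid_mem_Ioo x).1.le
        (le_sigmoid_of_mem_Ioo hM.cutPF_mem hx) (sub_pos.1 hlt).le)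
  linarith

theorem le_flow_add (hV : IsLogOddsSolution hM V) (ξ : ℝ) :
    M.r * V ξ ≤ max (M.g * Real.sigmoid ξ) M.s + M.phi M.topValue := by
  have hsafe : ∀ x ≤ logOdds M.cutSP,
      M.r * V x ≤ max (M.g * Real.sigmoid x) M.s + M.phi M.topValue := fun x hx => by
    rw [hV.eq_safe x hx, mul_div_cancel₀ _ hM.r_pos.ne']
    exact le_add_of_le_of_nonneg (le_max_right _ _) (hM.phi_nonneg _)
  rcases le_total ξ (logOdds M.cutSP) with hξ | hξ
  · exact hsafe ξ hξ
  refine le_barrier_of_deriv_nonpos (f := fun x => M.r * V x)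
    (f' := fun x => M.r * hM.slope (Real.sigmoid x) (V x))
    (u := fun x => max (M.g * Real.sigmoid x) M.s + M.phi M.topValue)
    (hV.continuous.const_mul _).continuousOn (Continuous.continuousOn (by fun_prop))
    (fun x _ y _ hxy => ?_) (fun x hx => ?_) (hsafe _ le_rfl) (fun x _ hlt => ?_) ξ ⟨hξ, le_rfl⟩
  · have := hM.g_pos
    have := Real.sigmoid_le_iff.2 hxy
    dsimp only
    gcongr
  · exact (hV.hasDerivAt (le_sigmoid_of_mem_Ioo hM.cutSP_mem hx)).const_mul _
  · exact mul_nonpos_of_nonneg_of_nonpos hM.r_pos.le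
      (hM.slope_nonpos (Ioo_subset_Icc_self (sigmoid_mem_Ioo x)) (hV.mem x).1 hlt.le)

theorem hasDerivAt_surplus (hV : IsLogOddsSolution hM V) {ξ : ℝ}
    (hξ : M.cutPF ≤ Real.sigmoid ξ) :
    HasDerivAt (fun x => M.r * V x - M.g * Real.sigmoid x)
      (-Real.sigmoid ξ * (M.r * V ξ - M.g * Real.sigmoid ξ) -
        M.r / M.lam * hM.invPhi (M.r * V ξ - M.g * Real.sigmoid ξ)) ξ := by
  refine (((hV.hasDerivAt (hM.cutSP_lt_cutPF.le.trans hξ)).const_mul M.r).sub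
    ((Real.hasDerivAt_sigmoid ξ).const_mul M.g)).congr_deriv ?_
  rw [Standing.slope, max_eq_left (hM.cutPF_le_iff.1 hξ), sub_self, zero_sub]
  have := hM.r_pos.ne'
  field_simp
  ring

/-- The surplus over the risky flow satisfies `u' ≤ -k √u`, because the optimal gain is at most
quadratic near `0`; hence it vanishes in finite time. -/
theorem riskySet_nonempty (hV : IsLogOddsSolution hM V) :
    (M.riskySet V).Nonempty := by
  obtain ⟨C, hC, hsqrt⟩ := hM.exists_sqrt_le_invPhi
  have hk : 0 < M.r / M.lam := div_pos hM.r_pos hM.lam_pos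
  have hsurplus : ∀ ξ, 0 ≤ M.r * V ξ - M.g * Real.sigmoid ξ := fun ξ =>
    sub_nonneg.2 ((le_max_left _ _).trans (hV.flow_le ξ))
  refine exists_eq_zero_of_deriv_le_neg_sqrt (div_pos hk hC)
    (fun ξ hξ => hV.hasDerivAt_surplus ((logOdds_le_iff hM.cutPF_mem).1 hξ))
    (fun ξ _ => hsurplus ξ) fun ξ _ => ?_
  have h1 := mul_nonneg (sigmoid_mem_Ioo ξ).1.le (hsurplus ξ)
  have h2 := mul_le_mul_of_nonneg_left (hsqrt _ (hsurplus ξ)) (div_pos hk hC).le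
  have h3 : ∀ y, M.r / M.lam / C * (C * y) = M.r / M.lam * y := fun y => by field_simp
  rw [h3] at h2
  linarith

theorem exists_isLeast_riskySet (hV : IsLogOddsSolution hM V) :
    ∃ ξN, IsLeast (M.riskySet V) ξN := by
  have hcont := hV.continuous
  have hclosed : IsClosed (M.riskySet V) :=
    isClosed_Ici.inter (isClosed_eq (by fun_prop) continuous_const)
  exact ⟨_, hclosed.isLeast_csInf hV.riskySet_nonempty ⟨_, fun ξ hξ => hξ.1⟩⟩

theorem risky_lt_of_lt (hV : IsLogOddsSolution hM V) {ξN ξ : ℝ}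
    (hN : IsLeast (M.riskySet V) ξN)
    (hξ : ξ < ξN) : M.g * Real.sigmoid ξ < M.r * V ξ := by
  rcases lt_or_ge (Real.sigmoid ξ) M.cutPF with h | h
  · exact (hM.lt_cutPF_iff.1 h).trans_le (hV.safe_le ξ)
  · refine ((le_max_left _ _).trans (hV.flow_le ξ)).lt_of_ne fun heq => hξ.not_ge ?_
    exact hN.2 ⟨(logOdds_le_iff hM.cutPF_mem).2 h, sub_eq_zero.2 heq.symm⟩

theorem logOdds_cutPF_lt (hV : IsLogOddsSolution hM V) {ξN : ℝ}
    (hN : IsLeast (M.riskySet V) ξN) :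
    logOdds M.cutPF < ξN := by
  refine hN.1.1.lt_of_ne fun heq => ?_
  have hzero := hN.1.2
  have hlt := hV.safe_lt (ξ := ξN)
    (by rw [← heq, sigmoid_logOdds hM.cutPF_mem]; exact hM.cutSP_lt_cutPF)
  rw [← heq, sigmoid_logOdds hM.cutPF_mem, hM.g_mul_cutPF, heq] at hzero
  rw [div_lt_iff₀' hM.r_pos] at hlt
  linarith

theorem eq_risky_of_le (hV : IsLogOddsSolution hM V) {ξN ξ : ℝ}
    (hN : IsLeast (M.riskySet V) ξN)
    (hξ : ξN ≤ ξ) : M.r * V ξ = M.g * Real.sigmoid ξ := by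
  have hbelow : M.r * V ξ - M.g * Real.sigmoid ξ ≤ 0 := by
    have hcont := hV.continuous
    refine le_barrier_of_deriv_nonpos (u := fun _ => 0) (Continuous.continuousOn (by fun_prop))
      continuousOn_const monotoneOn_const (fun x hx => hV.hasDerivAt_surplus
        ((logOdds_le_iff hM.cutPF_mem).1 (hN.1.1.trans hx.1.le))) hN.1.2.le
      (fun x _ hpos => ?_) ξ ⟨hξ, le_rfl⟩
    have h1 := mul_nonneg (sigmoid_mem_Ioo x).1.le hpos.le
    have h2 := mul_nonneg (div_pos hM.r_pos hM.lam_pos).le (hM.invPhi_nonneg hpos.le)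
    linarith
  linarith [(le_max_left _ _).trans (hV.flow_le ξ)]

end IsLogOddsSolution

/-- The gain, before the bonus is paid, from a purchase that is reported, if the continuation value
is `W`: what good news adds to `W`, corrected for the decline of the belief without it, less the
flow lost if a buyer of the safe product had to be induced to buy the risky one. -/
noncomputable def reportValue (M : Market) (W : ℝ → ℝ) (α : ℝ) : ℝ :=
  M.lam * α * (M.g / M.r - W α - (1 - α) * deriv W α) + (M.g * α - max (M.g * α) M.s)

end Market

/-- Continuously differentiable functions of the belief whose values and whose derivatives in the
log-odds are bounded: enough for integration along plans. -/
structure IsTestFunction (W : ℝ → ℝ) : Prop where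
  contDiffOn : ContDiffOn ℝ 1 W (Ioo 0 1)
  bounded : ∃ C, ∀ α ∈ Ioo (0 : ℝ) 1, |W α| ≤ C ∧ |α * (1 - α) * deriv W α| ≤ C

namespace Market

/-- A solution of the Bellman equation in the form `r W = max (g α) s + φ(y)`, with experimentation
exactly between `cutSP` and the free boundary `αFN`. -/
structure IsFreeBoundarySolution (M : Market) (W : ℝ → ℝ) (αFN : ℝ) : Prop
    extends IsTestFunction W where
  cutPF_lt : M.cutPF < αFN
  lt_one : αFN < 1
  value_eq : ∀ α ∈ Ioo (0 : ℝ) 1, M.r * W α = max (M.g * α) M.s + M.phi (M.reportValue W α)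
  reportValue_lt : ∀ α ∈ Ioo (0 : ℝ) 1, M.reportValue W α < M.cbar
  reportValue_pos_iff : ∀ α ∈ Ioo (0 : ℝ) 1, 0 < M.reportValue W α ↔ α ∈ Ioo M.cutSP αFN

namespace IsLogOddsSolution

variable {M : Market} {hM : M.Standing} {V : ℝ → ℝ} {α : ℝ}

theorem hasDerivAt_comp_logOdds (hV : IsLogOddsSolution hM V) (hα : α ∈ Ioo (0 : ℝ) 1) :
    HasDerivAt (V ∘ logOdds) (hM.slope (max M.cutSP α) (V (logOdds α)) * (α * (1 - α))⁻¹) α := by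
  have hderiv := hV.hasDerivAt_max (logOdds α)
  rw [sigmoid_logOdds hα] at hderiv
  exact hderiv.comp α (hasDerivAt_logOdds hα)

theorem mul_deriv_comp_logOdds (hV : IsLogOddsSolution hM V) (hα : α ∈ Ioo (0 : ℝ) 1) :
    α * (1 - α) * deriv (V ∘ logOdds) α = hM.slope (max M.cutSP α) (V (logOdds α)) := by
  rw [(hV.hasDerivAt_comp_logOdds hα).deriv]
  have h0 := hα.1.ne'
  have h1 := (sub_pos.2 hα.2).ne'
  field_simp

theorem isTestFunction (hV : IsLogOddsSolution hM V) : IsTestFunction (V ∘ logOdds) := by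
  have hderiv := fun α hα => hV.hasDerivAt_comp_logOdds (α := α) hα
  refine ⟨?_, ?_⟩
  · rw [← zero_add 1, contDiffOn_succ_iff_deriv_of_isOpen isOpen_Ioo, contDiffOn_zero]
    refine ⟨fun α hα => (hderiv α hα).differentiableAt.differentiableWithinAt, by simp, ?_⟩
    have hcont : ContinuousOn logOdds (Ioo 0 1) := fun α hα =>
      (hasDerivAt_logOdds hα).continuousAt.continuousWithinAt
    have hslope : ContinuousOn (fun α => hM.slope (max M.cutSP α) (V (logOdds α))) (Ioo 0 1) :=
      hM.slope_continuous.comp_continuousOn ((by fun_prop : ContinuousOn (max M.cutSP) _).prodMk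
        (hV.continuous.comp_continuousOn hcont))
    refine (hslope.mul ((by fun_prop : ContinuousOn (fun α : ℝ => α * (1 - α)) _).inv₀
      fun α hα => (mul_pos hα.1 (sub_pos.2 hα.2)).ne')).congr fun α hα => (hderiv α hα).deriv
  · obtain ⟨C, hC⟩ := hM.exists_abs_slope_le
    refine ⟨max (M.g / M.r) C, fun α hα => ⟨?_, ?_⟩⟩
    · have hmem := hV.mem (logOdds α)
      rw [Function.comp_apply, abs_of_nonneg ((div_pos hM.s_pos hM.r_pos).le.trans hmem.1)]
      exact hmem.2.trans (le_max_left _ _)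
    · rw [hV.mul_deriv_comp_logOdds hα]
      exact (hC _ ⟨le_max_of_le_right hα.1.le, max_le hM.cutSP_mem.2.le hα.2.le⟩ _
        (hV.mem _)).trans (le_max_right _ _)

theorem reportValue_eq (hV : IsLogOddsSolution hM V) (hα : α ∈ Ioo (0 : ℝ) 1) :
    M.reportValue (V ∘ logOdds) α = M.lam * α * (M.g / M.r - V (logOdds α)) -
      M.lam * hM.slope (max M.cutSP α) (V (logOdds α)) + (M.g * α - max (M.g * α) M.s) := by
  rw [← hV.mul_deriv_comp_logOdds hα, reportValue, Function.comp_apply]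
  ring

theorem reportValue_of_lt (hV : IsLogOddsSolution hM V) (hα : α ∈ Ioo (0 : ℝ) 1)
    (h : α < M.cutSP) : M.reportValue (V ∘ logOdds) α < 0 := by
  have hflow := (hM.lt_cutPF_iff.1 (h.trans hM.cutSP_lt_cutPF)).le
  have hξ : V (logOdds α) = M.s / M.r := by
    refine hV.eq_safe _ ((logOdds_le_iff hα).2 ?_)
    rw [sigmoid_logOdds hM.cutSP_mem]
    exact h.le
  rw [hV.reportValue_eq hα, hξ, max_eq_left h.le, hM.slope_cutSP_safe, mul_zero, sub_zero,
    max_eq_right hflow, hM.safe_report_value]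
  exact mul_neg_of_neg_of_pos (sub_neg.2 h) (div_pos hM.cutSP_denom_pos hM.r_pos)

theorem reportValue_of_le (hV : IsLogOddsSolution hM V) (hα : α ∈ Ioo (0 : ℝ) 1)
    (h : M.cutSP ≤ α) :
    M.reportValue (V ∘ logOdds) α = hM.invPhi (M.r * V (logOdds α) - max (M.g * α) M.s) := by
  rw [hV.reportValue_eq hα, max_eq_right h, hM.lam_mul_slope]
  ring

theorem flow_le_value (hV : IsLogOddsSolution hM V) (hα : α ∈ Ioo (0 : ℝ) 1) :
    max (M.g * α) M.s ≤ M.r * V (logOdds α) := by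
  simpa only [sigmoid_logOdds hα] using hV.flow_le (logOdds α)

theorem value_le_flow_add (hV : IsLogOddsSolution hM V) (hα : α ∈ Ioo (0 : ℝ) 1) :
    M.r * V (logOdds α) ≤ max (M.g * α) M.s + M.phi M.topValue := by
  simpa only [sigmoid_logOdds hα] using hV.le_flow_add (logOdds α)

theorem flow_lt_value_iff (hV : IsLogOddsSolution hM V) {ξN : ℝ} (hN : IsLeast (M.riskySet V) ξN)
    (hα : α ∈ Ioo (0 : ℝ) 1) (h : M.cutSP ≤ α) :
    max (M.g * α) M.s < M.r * V (logOdds α) ↔ α ∈ Ioo M.cutSP (Real.sigmoid ξN) := by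
  refine ⟨fun hlt => ⟨h.lt_of_ne ?_, ?_⟩, fun hmem => max_lt ?_ ?_⟩
  · rintro rfl
    rw [hV.eq_safe _ le_rfl, mul_div_cancel₀ _ hM.r_pos.ne'] at hlt
    exact (le_max_right _ _).not_gt hlt
  · by_contra! hle
    have heq := hV.eq_risky_of_le hN (ξ := logOdds α)
      (by rwa [← Real.sigmoid_le_iff, sigmoid_logOdds hα])
    rw [sigmoid_logOdds hα] at heq
    exact (le_max_left _ _).not_gt (heq ▸ hlt)
  · have hlt := hV.risky_lt_of_lt hN (ξ := logOdds α)
      (lt_of_not_ge fun hle => hmem.2.not_ge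
        (by rwa [← Real.sigmoid_le_iff, sigmoid_logOdds hα] at hle))
    rwa [sigmoid_logOdds hα] at hlt
  · rw [← div_lt_iff₀' hM.r_pos]
    exact hV.safe_lt (by rw [sigmoid_logOdds hα]; exact hmem.1)

theorem isFreeBoundarySolution (hV : IsLogOddsSolution hM V) {ξN : ℝ}
    (hN : IsLeast (M.riskySet V) ξN) :
    M.IsFreeBoundarySolution (V ∘ logOdds) (Real.sigmoid ξN) where
  toIsTestFunction := hV.isTestFunction
  cutPF_lt := by
    rw [← sigmoid_logOdds hM.cutPF_mem, Real.sigmoid_lt_iff]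
    exact hV.logOdds_cutPF_lt hN
  lt_one := Real.sigmoid_lt_one ξN
  value_eq α hα := by
    rcases lt_or_ge α M.cutSP with h | h
    · rw [hM.phi_of_nonpos (hV.reportValue_of_lt hα h).le, add_zero, Function.comp_apply,
        hV.eq_safe _ ((logOdds_le_iff hα).2 (by rw [sigmoid_logOdds hM.cutSP_mem]; exact h.le)),
        mul_div_cancel₀ _ hM.r_pos.ne',
        max_eq_right (hM.lt_cutPF_iff.1 (h.trans hM.cutSP_lt_cutPF)).le]
    · rw [hV.reportValue_of_le hα h, hM.phi_invPhi (sub_nonneg.2 (hV.flow_le_value hα)),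
        Function.comp_apply, add_sub_cancel]
  reportValue_lt α hα := by
    rcases lt_or_ge α M.cutSP with h | h
    · exact (hV.reportValue_of_lt hα h).trans hM.cbar_pos
    · rw [hV.reportValue_of_le hα h]
      refine lt_of_le_of_lt ?_ hM.topValue_lt_cbar
      rw [← hM.invPhi_phi hM.topValue_pos.le]
      exact hM.invPhi.monotone (sub_le_iff_le_add'.2 (hV.value_le_flow_add hα))
  reportValue_pos_iff α hα := by
    rcases lt_or_ge α M.cutSP with h | h
    · exact iff_of_false (hV.reportValue_of_lt hα h).not_gt fun hmem => hmem.1.not_gt h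
    · rw [hV.reportValue_of_le hα h, hM.invPhi_pos_iff, sub_pos, hV.flow_lt_value_iff hN hα h]

end IsLogOddsSolution

theorem Standing.exists_isFreeBoundarySolution {M : Market} (hM : M.Standing) :
    ∃ W αFN, M.IsFreeBoundarySolution W αFN := by
  obtain ⟨V, hV⟩ := hM.exists_isLogOddsSolution
  obtain ⟨ξN, hN⟩ := hV.exists_isLeast_riskySet
  exact ⟨_, _, hV.isFreeBoundarySolution hN⟩

/-! ### The Bellman equation -/

variable {M : Market}

/-- The profit flow lost by promoting the arm `ℓ` instead of the better one at belief `α`. -/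
noncomputable def armLoss (M : Market) (α : ℝ) : Arm → ℝ
  | Arm.risky => max (M.g * α) M.s - M.g * α
  | Arm.safe => max (M.g * α) M.s - M.s

theorem armLoss_nonneg (α : ℝ) (ℓ : Arm) : 0 ≤ M.armLoss α ℓ := by
  cases ℓ
  · exact sub_nonneg.2 (le_max_left _ _)
  · exact sub_nonneg.2 (le_max_right _ _)

theorem Standing.armLoss_risky_eq_zero_iff (hM : M.Standing) {α : ℝ} :
    M.armLoss α Arm.risky = 0 ↔ M.cutPF ≤ α := by
  rw [armLoss, sub_eq_zero, max_eq_left_iff, hM.cutPF_le_iff]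

theorem Standing.armLoss_safe_eq_zero_iff (hM : M.Standing) {α : ℝ} :
    M.armLoss α Arm.safe = 0 ↔ α ≤ M.cutPF := by
  rw [armLoss, sub_eq_zero, max_eq_right_iff, cutPF, le_div_iff₀' hM.g_pos]

theorem bellman_eq (W : ℝ → ℝ) (α : ℝ) (a : StageAction) :
    M.bellman W α a = max (M.g * α) M.s + M.H a.bonus * (M.reportValue W α - a.bonus) -
      (1 - M.H a.bonus) * M.armLoss α a.arm := by
  rcases a with ⟨ℓ, b⟩
  cases ℓ <;> simp only [bellman, flow, reportValue, armLoss, g] <;> ring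

theorem Standing.one_sub_H_mul_armLoss_nonneg (hM : M.Standing) (α : ℝ) {a : StageAction}
    (ha : M.Feasible a) : 0 ≤ (1 - M.H a.bonus) * M.armLoss α a.arm :=
  mul_nonneg (sub_nonneg.2 (hM.H_le_one ha)) (armLoss_nonneg α a.arm)

namespace IsFreeBoundarySolution

variable {W : ℝ → ℝ} {α αFN : ℝ} {a : StageAction}

theorem reportValue_nonpos (hW : M.IsFreeBoundarySolution W αFN) (hα : α ∈ Ioo (0 : ℝ) 1)
    (h : α ∉ Ioo M.cutSP αFN) : M.reportValue W α ≤ 0 :=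
  not_lt.1 <| mt (hW.reportValue_pos_iff α hα).1 h

theorem free_boundary_pos (hW : M.IsFreeBoundarySolution W αFN) (hM : M.Standing) : 0 < αFN :=
  hM.cutPF_mem.1.trans hW.cutPF_lt

theorem eq_safe (hW : M.IsFreeBoundarySolution W αFN) (hM : M.Standing)
    (hα : α ∈ Ioc 0 M.cutSP) : W α = M.s / M.r := by
  have hα₁ : α ∈ Ioo (0 : ℝ) 1 := ⟨hα.1, hα.2.trans_lt hM.cutSP_mem.2⟩
  rw [eq_div_iff hM.r_pos.ne', mul_comm, hW.value_eq α hα₁,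
    hM.phi_of_nonpos (hW.reportValue_nonpos hα₁ fun h => h.1.not_ge hα.2), add_zero,
    max_eq_right (hM.lt_cutPF_iff.1 (hα.2.trans_lt hM.cutSP_lt_cutPF)).le]

theorem eq_risky (hW : M.IsFreeBoundarySolution W αFN) (hM : M.Standing) (hα : α ∈ Ico αFN 1) :
    W α = α * M.z * M.lam / M.r := by
  have hα₁ : α ∈ Ioo (0 : ℝ) 1 := ⟨(hW.free_boundary_pos hM).trans_le hα.1, hα.2⟩
  rw [eq_div_iff hM.r_pos.ne', mul_comm, hW.value_eq α hα₁,
    hM.phi_of_nonpos (hW.reportValue_nonpos hα₁ fun h => h.2.not_ge hα.1), add_zero,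
    max_eq_left (hM.cutPF_le_iff.1 (hW.cutPF_lt.le.trans hα.1)), g]
  ring

theorem risky_lt (hW : M.IsFreeBoundarySolution W αFN) (hM : M.Standing) (hα : α ∈ Ioo 0 αFN) :
    α * M.z * M.lam / M.r < W α := by
  have hα₁ : α ∈ Ioo (0 : ℝ) 1 := ⟨hα.1, hα.2.trans hW.lt_one⟩
  rw [div_lt_iff₀' hM.r_pos, hW.value_eq α hα₁, show α * M.z * M.lam = M.g * α by unfold g; ring]
  rcases lt_or_ge α M.cutPF with h | h
  · exact ((hM.lt_cutPF_iff.1 h).trans_le (le_max_right _ _)).trans_le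
      (le_add_of_nonneg_right (hM.phi_nonneg _))
  · exact (le_max_left _ _).trans_lt (lt_add_of_pos_right _ (hM.phi_pos
      ((hW.reportValue_pos_iff α hα₁).2 ⟨hM.cutSP_lt_cutPF.trans_le h, hα.2⟩)))

theorem isLeast_eq_risky (hW : M.IsFreeBoundarySolution W αFN) (hM : M.Standing) :
    IsLeast {x | x ∈ Ioo (0 : ℝ) 1 ∧ W x = x * M.z * M.lam / M.r} αFN := by
  refine ⟨⟨⟨hW.free_boundary_pos hM, hW.lt_one⟩, hW.eq_risky hM ⟨le_rfl, hW.lt_one⟩⟩, ?_⟩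
  rintro x ⟨hx, hval⟩
  by_contra! hlt
  exact (hW.risky_lt hM ⟨hx.1, hlt⟩).ne' hval

theorem congr (hW : M.IsFreeBoundarySolution W αFN) {V : ℝ → ℝ} (hV : EqOn V W (Ioo 0 1)) :
    M.IsFreeBoundarySolution V αFN := by
  have hderiv : EqOn (deriv V) (deriv W) (Ioo 0 1) := hV.deriv isOpen_Ioo
  have hreport : ∀ α ∈ Ioo (0 : ℝ) 1, M.reportValue V α = M.reportValue W α := fun α hα => by
    rw [reportValue, reportValue, hV hα, hderiv hα]
  obtain ⟨C, hC⟩ := hW.bounded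
  refine ⟨⟨hW.contDiffOn.congr hV, C, fun α hα => ?_⟩, hW.cutPF_lt, hW.lt_one,
    fun α hα => ?_, fun α hα => ?_, fun α hα => ?_⟩
  · simpa only [hV hα, hderiv hα] using hC α hα
  · rw [hV hα, hreport α hα, hW.value_eq α hα]
  · rw [hreport α hα]
    exact hW.reportValue_lt α hα
  · rw [hreport α hα, hW.reportValue_pos_iff α hα]

theorem bellman_le (hW : M.IsFreeBoundarySolution W αFN) (hM : M.Standing)
    (hα : α ∈ Ioo (0 : ℝ) 1) (ha : M.Feasible a) : M.bellman W α a ≤ M.r * W α := by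
  rw [bellman_eq, hW.value_eq α hα]
  linarith [hM.le_phi (M.reportValue W α) ha, hM.one_sub_H_mul_armLoss_nonneg α ha]

theorem bellman_bestBonus (hW : M.IsFreeBoundarySolution W αFN) (hα : α ∈ Ioo (0 : ℝ) 1)
    {ℓ : Arm} (hℓ : M.armLoss α ℓ = 0) :
    M.bellman W α ⟨ℓ, M.bestBonus (M.reportValue W α)⟩ = M.r * W α := by
  rw [bellman_eq, hW.value_eq α hα, hℓ, mul_zero, sub_zero, phi]

theorem armEq (hW : M.IsFreeBoundarySolution W αFN) (hM : M.Standing) (hα : α ∈ Ioo (0 : ℝ) 1)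
    {ℓ : Arm} (hℓ : M.armLoss α ℓ = 0) : M.ArmEq ℓ W α :=
  ⟨⟨_, hM.bestBonus_mem _, hW.bellman_bestBonus hα hℓ⟩,
    forall_mem_image.2 fun _ hb => hW.bellman_le hM hα hb⟩

theorem gain_eq_phi_of_bellman_eq (hW : M.IsFreeBoundarySolution W αFN) (hM : M.Standing)
    (hα : α ∈ Ioo (0 : ℝ) 1) (ha : M.Feasible a) (h : M.bellman W α a = M.r * W α) :
    M.H a.bonus * (M.reportValue W α - a.bonus) = M.phi (M.reportValue W α) := by
  rw [bellman_eq, hW.value_eq α hα] at h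
  linarith [hM.le_phi (M.reportValue W α) ha, hM.one_sub_H_mul_armLoss_nonneg α ha]

theorem bonus_mem_of_bellman_eq (hW : M.IsFreeBoundarySolution W αFN) (hM : M.Standing)
    (hα : α ∈ Ioo M.cutSP αFN) (ha : M.Feasible a) (h : M.bellman W α a = M.r * W α) :
    0 < a.bonus ∧ a.bonus < M.cbar := by
  have hα₁ : α ∈ Ioo (0 : ℝ) 1 := ⟨hM.cutSP_pos.trans hα.1, hα.2.trans hW.lt_one⟩
  obtain ⟨hpos, hlt⟩ := hM.pos_of_eq_phi ((hW.reportValue_pos_iff α hα₁).2 hα) ha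
    (hW.gain_eq_phi_of_bellman_eq hM hα₁ ha h)
  exact ⟨hpos, hlt.trans (hW.reportValue_lt α hα₁)⟩

theorem bonus_eq_zero_of_bellman_eq (hW : M.IsFreeBoundarySolution W αFN) (hM : M.Standing)
    (hα : α ∈ Ioo (0 : ℝ) 1) (hout : α ∉ Ioo M.cutSP αFN) (ha : M.Feasible a)
    (h : M.bellman W α a = M.r * W α) : a.bonus = 0 :=
  hM.eq_zero_of_eq_phi (hW.reportValue_nonpos hα hout) ha
    (hW.gain_eq_phi_of_bellman_eq hM hα ha h)

theorem armLoss_eq_zero_of_bellman_eq (hW : M.IsFreeBoundarySolution W αFN) (hM : M.Standing)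
    (hα : α ∈ Ioo (0 : ℝ) 1) (ha : M.Feasible a) (h : M.bellman W α a = M.r * W α) :
    M.armLoss α a.arm = 0 := by
  have hbonus : a.bonus < M.cbar := by
    by_cases hmem : α ∈ Ioo M.cutSP αFN
    · exact (hW.bonus_mem_of_bellman_eq hM hmem ha h).2
    · exact (hW.bonus_eq_zero_of_bellman_eq hM hα hmem ha h).trans_lt hM.cbar_pos
  have hphi := hW.gain_eq_phi_of_bellman_eq hM hα ha h
  rw [bellman_eq, hW.value_eq α hα, hphi, sub_eq_self] at h
  exact (mul_eq_zero.1 h).resolve_left (sub_pos.2 (hM.H_lt_one ha hbonus)).ne'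

theorem prescribed (hW : M.IsFreeBoundarySolution W αFN) (hM : M.Standing)
    (hα : α ∈ Ioo (0 : ℝ) 1) (ha : M.Feasible a) (h : M.bellman W α a = M.r * W α) :
    M.Prescribed M.cutSP M.cutPF αFN α a := by
  have hloss := hW.armLoss_eq_zero_of_bellman_eq hM hα ha h
  have hsafe (hlt : α < M.cutPF) : a.arm = Arm.safe := by
    cases hℓ : a.arm
    · exact absurd (hM.armLoss_risky_eq_zero_iff.1 (hℓ ▸ hloss)) hlt.not_ge
    · rfl
  have hrisky (hlt : M.cutPF < α) : a.arm = Arm.risky := by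
    cases hℓ : a.arm
    · rfl
    · exact absurd (hM.armLoss_safe_eq_zero_iff.1 (hℓ ▸ hloss)) hlt.not_ge
  have hzero := fun hout => hW.bonus_eq_zero_of_bellman_eq hM hα hout ha h
  have hinterior := fun hmem => hW.bonus_mem_of_bellman_eq hM hmem ha h
  exact ⟨fun hm => ⟨hsafe (hm.2.trans hM.cutSP_lt_cutPF), hzero fun hmem => hmem.1.not_gt hm.2⟩,
    fun hm => ⟨hsafe hm.2, hinterior ⟨hm.1, hm.2.trans hW.cutPF_lt⟩⟩,
    fun hm => ⟨hrisky hm.1, hinterior ⟨hM.cutSP_lt_cutPF.trans hm.1, hm.2⟩⟩,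
    fun hm => ⟨hrisky (hW.cutPF_lt.trans hm.1), hzero fun hmem => hmem.2.not_gt hm.1⟩⟩

end IsFreeBoundarySolution

/-! ### Beliefs along a plan -/

namespace Plan

theorem H_nonneg (P : M.Plan) (hM : M.Standing) (t : ℝ) : 0 ≤ M.H (P.act t).bonus :=
  hM.H_nonneg (P.feasible t)

theorem H_le_one (P : M.Plan) (hM : M.Standing) (t : ℝ) : M.H (P.act t).bonus ≤ 1 :=
  hM.H_le_one (P.feasible t)

theorem measurable_H (P : M.Plan) (hM : M.Standing) :
    Measurable fun t => M.H (P.act t).bonus := by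
  have hcont : Continuous (IccExtend hM.cbar_pos.le ((Icc 0 M.cbar).domRestrict M.H)) :=
    hM.H_continuousOn.domRestrict.Icc_extend'
  have hextend : (fun t => M.H (P.act t).bonus) =
      IccExtend hM.cbar_pos.le ((Icc 0 M.cbar).domRestrict M.H) ∘ fun t => (P.act t).bonus :=
    funext fun t => (IccExtend_of_mem _ ((Icc 0 M.cbar).domRestrict M.H) (P.feasible t)).symm
  rw [hextend]
  exact hcont.measurable.comp P.bonus_measurable

theorem norm_H_le_one (P : M.Plan) (hM : M.Standing) (t : ℝ) : ‖M.H (P.act t).bonus‖ ≤ 1 := by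
  rw [Real.norm_of_nonneg (P.H_nonneg hM t)]
  exact P.H_le_one hM t

theorem locallyIntegrable_H (P : M.Plan) (hM : M.Standing) :
    LocallyIntegrable fun t => M.H (P.act t).bonus :=
  (locallyIntegrable_const (1 : ℝ)).mono (P.measurable_H hM).aestronglyMeasurable
    (Eventually.of_forall fun t => (P.norm_H_le_one hM t).trans_eq norm_one.symm)

theorem lipschitzWith_reports (P : M.Plan) (hM : M.Standing) : LipschitzWith 1 P.reports := by
  have hint (a b : ℝ) : IntervalIntegrable (fun t => M.H (P.act t).bonus) volume a b :=
    (LocallyIntegrable.integrableOn_isCompact (P.locallyIntegrable_H hM)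
      isCompact_uIcc).intervalIntegrable
  refine LipschitzWith.of_dist_le_mul fun x y => ?_
  rw [Real.dist_eq, Real.dist_eq, reports, reports,
    intervalIntegral.integral_interval_sub_left (hint _ _) (hint _ _)]
  exact intervalIntegral.norm_integral_le_of_norm_le_const fun t _ => P.norm_H_le_one hM t

theorem ae_hasDerivAt_reports (P : M.Plan) (hM : M.Standing) :
    ∀ᵐ t, HasDerivAt P.reports (M.H (P.act t).bonus) t := by
  filter_upwards [LocallyIntegrable.ae_hasDerivAt_integral (P.locallyIntegrable_H hM)] with t ht
  exact ht 0

theorem reports_nonneg (P : M.Plan) (hM : M.Standing) {t : ℝ} (ht : 0 ≤ t) : 0 ≤ P.reports t :=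
  intervalIntegral.integral_nonneg ht fun u _ => P.H_nonneg hM u

end Plan

/-- The probability of no good news as a function of the cumulated amount `R` of reports. -/
noncomputable def noNewsAt (M : Market) (α₀ R : ℝ) : ℝ := α₀ * Real.exp (-M.lam * R) + (1 - α₀)

/-- The belief in the absence of good news as a function of the cumulated amount `R` of reports. -/
noncomputable def beliefAt (M : Market) (α₀ R : ℝ) : ℝ :=
  α₀ * Real.exp (-M.lam * R) / M.noNewsAt α₀ R

section Bayes

variable {α₀ : ℝ}

theorem noNewsAt_pos (hα₀ : α₀ ∈ Ioo (0 : ℝ) 1) (R : ℝ) : 0 < M.noNewsAt α₀ R :=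
  add_pos (mul_pos hα₀.1 (Real.exp_pos _)) (sub_pos.2 hα₀.2)

theorem noNewsAt_le_one (hα₀ : 0 ≤ α₀) (hM : M.Standing) {R : ℝ} (hR : 0 ≤ R) :
    M.noNewsAt α₀ R ≤ 1 := by
  have hexp : Real.exp (-M.lam * R) ≤ 1 :=
    Real.exp_le_one_iff.2 (mul_nonpos_of_nonpos_of_nonneg (neg_nonpos.2 hM.lam_pos.le) hR)
  rw [noNewsAt]
  linarith [mul_le_of_le_one_right hα₀ hexp]

theorem noNewsAt_mul_beliefAt (hα₀ : α₀ ∈ Ioo (0 : ℝ) 1) (R : ℝ) :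
    M.noNewsAt α₀ R * M.beliefAt α₀ R = α₀ * Real.exp (-M.lam * R) :=
  mul_div_cancel₀ _ (noNewsAt_pos hα₀ R).ne'

theorem beliefAt_mem (hα₀ : α₀ ∈ Ioo (0 : ℝ) 1) (R : ℝ) : M.beliefAt α₀ R ∈ Ioo (0 : ℝ) 1 := by
  refine ⟨div_pos (mul_pos hα₀.1 (Real.exp_pos _)) (noNewsAt_pos hα₀ R), ?_⟩
  rw [beliefAt, div_lt_one (noNewsAt_pos hα₀ R), noNewsAt]
  linarith [hα₀.2]

theorem hasDerivAt_exp_neg_lam_mul (M : Market) (R : ℝ) :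
    HasDerivAt (fun R => Real.exp (-M.lam * R)) (-M.lam * Real.exp (-M.lam * R)) R := by
  simpa [mul_comm] using ((hasDerivAt_id R).const_mul (-M.lam)).exp

theorem hasDerivAt_noNewsAt (hα₀ : α₀ ∈ Ioo (0 : ℝ) 1) (R : ℝ) :
    HasDerivAt (M.noNewsAt α₀) (-M.lam * (M.noNewsAt α₀ R * M.beliefAt α₀ R)) R := by
  rw [noNewsAt_mul_beliefAt hα₀, mul_left_comm]
  exact ((M.hasDerivAt_exp_neg_lam_mul R).const_mul α₀).add_const (1 - α₀)

theorem hasDerivAt_beliefAt (hα₀ : α₀ ∈ Ioo (0 : ℝ) 1) (R : ℝ) : HasDerivAt (M.beliefAt α₀)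
    (-M.lam * (M.beliefAt α₀ R * (1 - M.beliefAt α₀ R))) R := by
  have hpos := (noNewsAt_pos (M := M) hα₀ R).ne'
  refine (((M.hasDerivAt_exp_neg_lam_mul R).const_mul α₀).div
    (hasDerivAt_noNewsAt hα₀ R) hpos).congr_deriv ?_
  rw [mul_left_comm, ← noNewsAt_mul_beliefAt hα₀]
  field_simp
  ring

theorem continuous_beliefAt (hα₀ : α₀ ∈ Ioo (0 : ℝ) 1) : Continuous (M.beliefAt α₀) :=
  continuous_iff_continuousAt.2 fun R => (hasDerivAt_beliefAt hα₀ R).continuousAt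

theorem continuous_noNewsAt (hα₀ : α₀ ∈ Ioo (0 : ℝ) 1) : Continuous (M.noNewsAt α₀) :=
  continuous_iff_continuousAt.2 fun R => (hasDerivAt_noNewsAt hα₀ R).continuousAt

end Bayes

/-! ### Discounted integrals along a plan -/

namespace Plan

variable {α₀ : ℝ}

/-- The weight of the profit flow at time `t` in the lifetime profit: the discount factor times the
probability that no good news has been reported. -/
noncomputable def weight (P : M.Plan) (α₀ t : ℝ) : ℝ := Real.exp (-M.r * t) * P.noNews α₀ t

/-- The profit flow plus the expected value of good news per unit of time. -/
noncomputable def earnings (P : M.Plan) (α₀ t : ℝ) : ℝ :=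
  M.flow (P.belief α₀ t) (P.act t) +
    M.H (P.act t).bonus * (P.belief α₀ t * M.lam) * (M.lam * M.z / M.r)

theorem profit_eq_integral_weight (P : M.Plan) (α₀ : ℝ) :
    P.profit α₀ = ∫ t in Ioi (0 : ℝ), P.weight α₀ t * P.earnings α₀ t := rfl

theorem belief_mem (P : M.Plan) (hα₀ : α₀ ∈ Ioo (0 : ℝ) 1) (t : ℝ) :
    P.belief α₀ t ∈ Ioo (0 : ℝ) 1 :=
  beliefAt_mem hα₀ _

theorem continuous_belief (P : M.Plan) (hM : M.Standing) (hα₀ : α₀ ∈ Ioo (0 : ℝ) 1) :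
    Continuous (P.belief α₀) :=
  (continuous_beliefAt hα₀).comp (P.lipschitzWith_reports hM).continuous

theorem continuous_weight (P : M.Plan) (hM : M.Standing) (hα₀ : α₀ ∈ Ioo (0 : ℝ) 1) :
    Continuous (P.weight α₀) :=
  (by fun_prop : Continuous fun t => Real.exp (-M.r * t)).mul
    ((continuous_noNewsAt hα₀).comp (P.lipschitzWith_reports hM).continuous)

theorem weight_pos (P : M.Plan) (hα₀ : α₀ ∈ Ioo (0 : ℝ) 1) (t : ℝ) : 0 < P.weight α₀ t :=
  mul_pos (Real.exp_pos _) (noNewsAt_pos hα₀ _)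

theorem norm_weight_mul_le (P : M.Plan) (hM : M.Standing) (hα₀ : α₀ ∈ Ioo (0 : ℝ) 1) {t : ℝ}
    (ht : 0 ≤ t) {x C : ℝ} (hx : |x| ≤ C) :
    ‖P.weight α₀ t * x‖ ≤ Real.exp (-M.r * t) * C := by
  rw [norm_mul, Real.norm_of_nonneg (P.weight_pos hα₀ t).le]
  exact mul_le_mul (mul_le_of_le_one_right (Real.exp_pos _).le
    (noNewsAt_le_one hα₀.1.le hM (P.reports_nonneg hM ht))) hx (abs_nonneg _) (Real.exp_pos _).le

theorem integrableOn_weight_mul (P : M.Plan) (hM : M.Standing) (hα₀ : α₀ ∈ Ioo (0 : ℝ) 1)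
    {f : ℝ → ℝ} (hf : Measurable f) {C : ℝ} (hC : ∀ t, |f t| ≤ C) :
    IntegrableOn (fun t => P.weight α₀ t * f t) (Ioi 0) := by
  refine ((exp_neg_integrableOn_Ioi 0 hM.r_pos).mul_const C).mono'
    ((P.continuous_weight hM hα₀).measurable.mul hf).aestronglyMeasurable ?_
  filter_upwards [ae_restrict_mem measurableSet_Ioi] with t ht using
    P.norm_weight_mul_le hM hα₀ ht.out.le (hC t)

theorem measurable_flow (P : M.Plan) (hM : M.Standing) (hα₀ : α₀ ∈ Ioo (0 : ℝ) 1) :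
    Measurable fun t => M.flow (P.belief α₀ t) (P.act t) := by
  classical
  have hH := P.measurable_H hM
  have hb := P.bonus_measurable
  have hα := (P.continuous_belief hM hα₀).measurable
  have hite : (fun t => M.flow (P.belief α₀ t) (P.act t)) = fun t =>
      if (P.act t).arm = Arm.risky then
        M.lam * P.belief α₀ t * M.z - M.H (P.act t).bonus * (P.act t).bonus
      else M.H (P.act t).bonus * (M.lam * P.belief α₀ t * M.z - (P.act t).bonus) +
        (1 - M.H (P.act t).bonus) * M.s := by
    funext t
    cases hℓ : (P.act t).arm <;> simp [flow, hℓ]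
  rw [hite]
  exact Measurable.ite P.arm_measurable (by fun_prop) (by fun_prop)

end Plan

theorem Standing.abs_flow_le (hM : M.Standing) {α : ℝ} (hα : α ∈ Ioo (0 : ℝ) 1) {a : StageAction}
    (ha : M.Feasible a) : |M.flow α a| ≤ M.g + M.cbar + M.s := by
  have hs := hM.s_pos
  have hH₀ := hM.H_nonneg ha
  have hH₁ := hM.H_le_one ha
  have hg₀ : 0 ≤ M.g * α := mul_nonneg hM.g_pos.le hα.1.le
  have hg₁ : M.g * α ≤ M.g := mul_le_of_le_one_right hM.g_pos.le hα.2.le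
  have hHb₀ := mul_nonneg hH₀ ha.1
  have hHb₁ := (mul_le_of_le_one_left ha.1 hH₁).trans ha.2
  have hHg₀ := mul_nonneg hH₀ hg₀
  have hHg₁ := mul_le_of_le_one_left hg₀ hH₁
  have hHs₀ := mul_nonneg hH₀ hs.le
  have hHs₁ := mul_le_of_le_one_left hs.le hH₁
  have hflow : M.lam * α * M.z = M.g * α := by unfold g; ring
  rcases a with ⟨ℓ, b⟩
  cases ℓ <;> simp only [flow, hflow, abs_le] <;> constructor <;> linarith

namespace Plan

variable {α₀ : ℝ}

theorem integrableOn_weight_mul_earnings (P : M.Plan) (hM : M.Standing)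
    (hα₀ : α₀ ∈ Ioo (0 : ℝ) 1) :
    IntegrableOn (fun t => P.weight α₀ t * P.earnings α₀ t) (Ioi 0) := by
  have hnews : 0 ≤ M.lam * M.z / M.r := (div_pos hM.g_pos hM.r_pos).le
  refine P.integrableOn_weight_mul hM hα₀ ((P.measurable_flow hM hα₀).add
    (((P.measurable_H hM).mul ((P.continuous_belief hM hα₀).measurable.mul_const _)).mul_const _))
    (C := M.g + M.cbar + M.s + M.lam * (M.lam * M.z / M.r)) fun t => ?_
  obtain ⟨hα_pos, hα_lt⟩ := P.belief_mem hα₀ t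
  have hrate : 0 ≤ P.belief α₀ t * M.lam := mul_nonneg hα_pos.le hM.lam_pos.le
  refine (abs_add_le _ _).trans
    (add_le_add (hM.abs_flow_le (P.belief_mem hα₀ t) (P.feasible t)) ?_)
  rw [abs_of_nonneg (mul_nonneg (mul_nonneg (P.H_nonneg hM t) hrate) hnews)]
  exact mul_le_mul_of_nonneg_right ((mul_le_of_le_one_left hrate (P.H_le_one hM t)).trans
    (mul_le_of_le_one_left hM.lam_pos.le hα_lt.le)) hnews

/-- The drift of the continuation value `W` along a plan, net of discounting and of the loss of `W`
when good news arrives. -/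
noncomputable def drift (P : M.Plan) (W : ℝ → ℝ) (α₀ t : ℝ) : ℝ :=
  -M.r * W (P.belief α₀ t) + M.H (P.act t).bonus *
    (-M.lam * P.belief α₀ t * (W (P.belief α₀ t) + (1 - P.belief α₀ t) * deriv W (P.belief α₀ t)))

/-- The amount by which the action at time `t` falls short of the Bellman equation. -/
noncomputable def shortfall (P : M.Plan) (W : ℝ → ℝ) (α₀ t : ℝ) : ℝ :=
  M.r * W (P.belief α₀ t) - M.bellman W (P.belief α₀ t) (P.act t)

theorem shortfall_eq (P : M.Plan) (W : ℝ → ℝ) (α₀ t : ℝ) :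
    P.shortfall W α₀ t = -P.drift W α₀ t - P.earnings α₀ t := by
  rw [shortfall, drift, earnings, bellman]
  ring

end Plan

end Market

namespace IsTestFunction

open Market

variable {M : Market} {W : ℝ → ℝ} {α₀ : ℝ}

/-! ### The verification argument -/

theorem hasDerivAt (hW : IsTestFunction W) {α : ℝ} (hα : α ∈ Ioo (0 : ℝ) 1) :
    HasDerivAt W (deriv W α) α :=
  ((hW.contDiffOn.contDiffAt (Ioo_mem_nhds hα.1 hα.2)).differentiableAt one_ne_zero).hasDerivAt

theorem continuousOn_deriv (hW : IsTestFunction W) : ContinuousOn (deriv W) (Ioo 0 1) :=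
  hW.contDiffOn.continuousOn_deriv_of_isOpen isOpen_Ioo le_rfl

theorem exists_abs_le (hW : IsTestFunction W) (hM : M.Standing) :
    ∃ C, 0 ≤ C ∧ ∀ α ∈ Ioo (0 : ℝ) 1,
      |W α| ≤ C ∧ |-M.lam * α * (W α + (1 - α) * deriv W α)| ≤ M.lam * (C + C) := by
  obtain ⟨C, hC⟩ := hW.bounded
  refine ⟨C, (abs_nonneg _).trans (hC (1 / 2) ⟨by norm_num, by norm_num⟩).1,
    fun α hα => ⟨(hC α hα).1, ?_⟩⟩
  obtain ⟨hvalue, hderiv⟩ := hC α hα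
  have hαW : |α * W α| ≤ C := by
    rw [abs_mul, abs_of_pos hα.1]
    exact (mul_le_of_le_one_left (abs_nonneg _) hα.2.le).trans hvalue
  rw [show -M.lam * α * (W α + (1 - α) * deriv W α) =
      -M.lam * (α * W α + α * (1 - α) * deriv W α) by ring,
    abs_mul, abs_neg, abs_of_pos hM.lam_pos]
  exact mul_le_mul_of_nonneg_left ((abs_add_le _ _).trans (add_le_add hαW hderiv)) hM.lam_pos.le

theorem measurable_drift (hW : IsTestFunction W) (hM : M.Standing) (hα₀ : α₀ ∈ Ioo (0 : ℝ) 1)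
    (P : M.Plan) : Measurable (P.drift W α₀) := by
  have hα := P.continuous_belief hM hα₀
  have hvalue : Measurable fun t => W (P.belief α₀ t) :=
    (hW.contDiffOn.continuousOn.comp_continuous hα (P.belief_mem hα₀)).measurable
  have hderiv : Measurable fun t => deriv W (P.belief α₀ t) :=
    (hW.continuousOn_deriv.comp_continuous hα (P.belief_mem hα₀)).measurable
  exact (hvalue.const_mul _).add ((P.measurable_H hM).mul
    ((hα.measurable.const_mul _).mul (hvalue.add ((hα.measurable.const_sub 1).mul hderiv))))

theorem integrableOn_weight_mul_drift (hW : IsTestFunction W) (hM : M.Standing)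
    (hα₀ : α₀ ∈ Ioo (0 : ℝ) 1) (P : M.Plan) :
    IntegrableOn (fun t => P.weight α₀ t * P.drift W α₀ t) (Ioi 0) := by
  obtain ⟨C, -, hC⟩ := hW.exists_abs_le hM
  refine P.integrableOn_weight_mul hM hα₀ (hW.measurable_drift hM hα₀ P)
    (C := M.r * C + M.lam * (C + C)) fun t => ?_
  obtain ⟨hvalue, hslope⟩ := hC _ (P.belief_mem hα₀ t)
  refine (abs_add_le _ _).trans (add_le_add ?_ ?_)
  · rw [abs_mul, abs_neg, abs_of_pos hM.r_pos]
    exact mul_le_mul_of_nonneg_left hvalue hM.r_pos.le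
  · rw [abs_mul, abs_of_nonneg (P.H_nonneg hM t)]
    exact (mul_le_of_le_one_left (abs_nonneg _) (P.H_le_one hM t)).trans hslope

theorem hasDerivAt_noNewsAt_mul (hW : IsTestFunction W) (hα₀ : α₀ ∈ Ioo (0 : ℝ) 1) (R : ℝ) :
    HasDerivAt (fun R => M.noNewsAt α₀ R * W (M.beliefAt α₀ R))
      (M.noNewsAt α₀ R * (-M.lam * M.beliefAt α₀ R *
        (W (M.beliefAt α₀ R) + (1 - M.beliefAt α₀ R) * deriv W (M.beliefAt α₀ R)))) R := by
  have hcomp := (hW.hasDerivAt (beliefAt_mem (M := M) hα₀ R)).comp R (hasDerivAt_beliefAt hα₀ R)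
  exact ((hasDerivAt_noNewsAt hα₀ R).mul hcomp).congr_deriv
    (by simp only [Function.comp_apply]; ring)

theorem exists_lipschitzOnWith_noNewsAt_mul (hW : IsTestFunction W) (hM : M.Standing)
    (hα₀ : α₀ ∈ Ioo (0 : ℝ) 1) :
    ∃ K, LipschitzOnWith K (fun R => M.noNewsAt α₀ R * W (M.beliefAt α₀ R)) (Ici 0) := by
  obtain ⟨C, hC₀, hC⟩ := hW.exists_abs_le hM
  have hlam := hM.lam_pos
  refine ⟨Real.toNNReal (M.lam * (C + C)),
    (convex_Ici 0).lipschitzOnWith_of_nnnorm_hasDerivWithin_le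
      (fun R _ => (hW.hasDerivAt_noNewsAt_mul hα₀ R).hasDerivWithinAt) fun R hR => ?_⟩
  rw [← NNReal.coe_le_coe, coe_nnnorm, Real.coe_toNNReal _ (by positivity), norm_mul,
    Real.norm_of_nonneg (noNewsAt_pos hα₀ R).le]
  exact (mul_le_of_le_one_left (abs_nonneg _) (noNewsAt_le_one hα₀.1.le hM hR)).trans
    (hC _ (beliefAt_mem hα₀ R)).2

theorem ae_hasDerivAt_weight_mul (hW : IsTestFunction W) (hM : M.Standing)
    (hα₀ : α₀ ∈ Ioo (0 : ℝ) 1) (P : M.Plan) :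
    ∀ᵐ t, HasDerivAt (fun t => P.weight α₀ t * W (P.belief α₀ t))
      (P.weight α₀ t * P.drift W α₀ t) t := by
  filter_upwards [P.ae_hasDerivAt_reports hM] with t hreports
  have hexp : HasDerivAt (fun t => Real.exp (-M.r * t)) (Real.exp (-M.r * t) * -M.r) t := by
    simpa using ((hasDerivAt_id t).const_mul (-M.r)).exp
  have hprod := hexp.mul
    ((hW.hasDerivAt_noNewsAt_mul (M := M) hα₀ (P.reports t)).comp t hreports)
  refine (hprod.congr_of_eventuallyEq (Eventually.of_forall fun u => ?_)).congr_deriv ?_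
  · exact mul_assoc _ _ _
  · change _ = Real.exp (-M.r * t) * M.noNewsAt α₀ (P.reports t) * P.drift W α₀ t
    simp only [Function.comp_apply, Plan.drift,
      show P.belief α₀ t = M.beliefAt α₀ (P.reports t) from rfl]
    ring

theorem intervalIntegral_weight_mul_drift (hW : IsTestFunction W) (hM : M.Standing)
    (hα₀ : α₀ ∈ Ioo (0 : ℝ) 1) (P : M.Plan) {T : ℝ} (hT : 0 ≤ T) :
    ∫ t in (0 : ℝ)..T, P.weight α₀ t * P.drift W α₀ t =
      P.weight α₀ T * W (P.belief α₀ T) - W α₀ := by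
  obtain ⟨K, hK⟩ := hW.exists_lipschitzOnWith_noNewsAt_mul hM hα₀
  have hmaps : MapsTo P.reports (uIcc 0 T) (Ici 0) := fun t ht => by
    rw [uIcc_of_le hT] at ht
    exact P.reports_nonneg hM ht.1
  have hac : AbsolutelyContinuousOnInterval (fun t => P.weight α₀ t * W (P.belief α₀ t)) 0 T := by
    have hexp : AbsolutelyContinuousOnInterval (fun t => Real.exp (-M.r * t)) 0 T :=
      ContDiffOn.absolutelyContinuousOnInterval (by fun_prop)
    have hlip := hK.comp (P.lipschitzWith_reports hM).lipschitzOnWith hmaps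
    convert hexp.mul hlip.absolutelyContinuousOnInterval using 2 with t
    exact mul_assoc _ _ _
  have hinitial : P.weight α₀ 0 * W (P.belief α₀ 0) = W α₀ := by
    simp [Plan.weight, Plan.belief, Plan.noNews, Plan.reports]
  rw [← hinitial, ← hac.integral_deriv_eq_sub]
  refine intervalIntegral.integral_congr_ae ?_
  filter_upwards [hW.ae_hasDerivAt_weight_mul hM hα₀ P] with t ht _ using ht.deriv.symm

theorem tendsto_weight_mul (hW : IsTestFunction W) (hM : M.Standing) (hα₀ : α₀ ∈ Ioo (0 : ℝ) 1)
    (P : M.Plan) : Tendsto (fun t => P.weight α₀ t * W (P.belief α₀ t)) atTop (𝓝 0) := by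
  obtain ⟨C, hC⟩ := hW.bounded
  have hexp : Tendsto (fun t => Real.exp (-M.r * t) * C) atTop (𝓝 0) := by
    simpa [Function.comp_def] using (Real.tendsto_exp_neg_atTop_nhds_zero.comp
      (tendsto_id.const_mul_atTop hM.r_pos)).mul_const C
  refine squeeze_zero_norm' ?_ hexp
  filter_upwards [eventually_ge_atTop 0] with t ht using
    P.norm_weight_mul_le hM hα₀ ht (hC _ (P.belief_mem hα₀ t)).1

theorem integral_weight_mul_drift (hW : IsTestFunction W) (hM : M.Standing)
    (hα₀ : α₀ ∈ Ioo (0 : ℝ) 1) (P : M.Plan) :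
    ∫ t in Ioi (0 : ℝ), P.weight α₀ t * P.drift W α₀ t = -W α₀ := by
  refine tendsto_nhds_unique
    (intervalIntegral_tendsto_integral_Ioi 0 (hW.integrableOn_weight_mul_drift hM hα₀ P)
      tendsto_id) ?_
  rw [← zero_sub]
  refine ((hW.tendsto_weight_mul hM hα₀ P).sub_const _).congr' ?_
  filter_upwards [eventually_ge_atTop 0] with T hT using
    (hW.intervalIntegral_weight_mul_drift hM hα₀ P hT).symm

theorem integrableOn_weight_mul_shortfall (hW : IsTestFunction W) (hM : M.Standing)
    (hα₀ : α₀ ∈ Ioo (0 : ℝ) 1) (P : M.Plan) :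
    IntegrableOn (fun t => P.weight α₀ t * P.shortfall W α₀ t) (Ioi 0) := by
  simp only [P.shortfall_eq, mul_sub, mul_neg]
  exact (hW.integrableOn_weight_mul_drift hM hα₀ P).neg.sub
    (P.integrableOn_weight_mul_earnings hM hα₀)

theorem profit_eq (hW : IsTestFunction W) (hM : M.Standing) (hα₀ : α₀ ∈ Ioo (0 : ℝ) 1)
    (P : M.Plan) :
    P.profit α₀ = W α₀ - ∫ t in Ioi (0 : ℝ), P.weight α₀ t * P.shortfall W α₀ t := by
  have hshortfall : ∫ t in Ioi (0 : ℝ), P.weight α₀ t * P.shortfall W α₀ t =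
      W α₀ - P.profit α₀ := by
    rw [← neg_neg (W α₀), ← hW.integral_weight_mul_drift hM hα₀ P, P.profit_eq_integral_weight,
      ← integral_neg]
    simp only [P.shortfall_eq, mul_sub, mul_neg]
    exact integral_sub (hW.integrableOn_weight_mul_drift hM hα₀ P).neg
      (P.integrableOn_weight_mul_earnings hM hα₀)
  rw [hshortfall, sub_sub_cancel]

end IsTestFunction

namespace Market.IsFreeBoundarySolution

variable {M : Market} {W : ℝ → ℝ} {α₀ αFN : ℝ}

theorem shortfall_nonneg (hW : M.IsFreeBoundarySolution W αFN) (hM : M.Standing)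
    (hα₀ : α₀ ∈ Ioo (0 : ℝ) 1) (P : M.Plan) (t : ℝ) : 0 ≤ P.shortfall W α₀ t :=
  sub_nonneg.2 (hW.bellman_le hM (P.belief_mem hα₀ t) (P.feasible t))

theorem profit_le (hW : M.IsFreeBoundarySolution W αFN) (hM : M.Standing)
    (hα₀ : α₀ ∈ Ioo (0 : ℝ) 1) (P : M.Plan) : P.profit α₀ ≤ W α₀ := by
  rw [hW.profit_eq hM hα₀ P]
  exact sub_le_self _ (integral_nonneg fun t =>
    mul_nonneg (P.weight_pos hα₀ t).le (hW.shortfall_nonneg hM hα₀ P t))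

theorem ae_bellman_eq (hW : M.IsFreeBoundarySolution W αFN) (hM : M.Standing)
    (hα₀ : α₀ ∈ Ioo (0 : ℝ) 1) {P : M.Plan} (hP : P.profit α₀ = W α₀) :
    ∀ᵐ t ∂(volume.restrict (Ioi (0 : ℝ))),
      M.bellman W (P.belief α₀ t) (P.act t) = M.r * W (P.belief α₀ t) := by
  have hzero : ∫ t in Ioi (0 : ℝ), P.weight α₀ t * P.shortfall W α₀ t = 0 := by
    linarith [hW.profit_eq hM hα₀ P]
  have hae := (integral_eq_zero_iff_of_nonneg
    (fun t => mul_nonneg (P.weight_pos hα₀ t).le (hW.shortfall_nonneg hM hα₀ P t))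
    (hW.integrableOn_weight_mul_shortfall hM hα₀ P)).1 hzero
  filter_upwards [hae] with t ht
  exact (sub_eq_zero.1 ((mul_eq_zero.1 ht).resolve_left (P.weight_pos hα₀ t).ne')).symm

end Market.IsFreeBoundarySolution

namespace Market

variable {M : Market} {W : ℝ → ℝ} {α₀ αFN : ℝ}

/-! ### The optimal policy -/

open Classical in
/-- The policy that promotes the arm with the larger current payoff and pays the bonus that is best
against the report value of the continuation profit `W`. -/
noncomputable def policy (M : Market) (W : ℝ → ℝ) (α : ℝ) : StageAction :=
  ⟨if M.cutPF ≤ α then Arm.risky else Arm.safe, M.bestBonus (M.reportValue W α)⟩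

theorem policy_arm_eq_risky_iff {α : ℝ} : (M.policy W α).arm = Arm.risky ↔ M.cutPF ≤ α := by
  simp [policy]

theorem Standing.feasible_policy (hM : M.Standing) (W : ℝ → ℝ) (α : ℝ) :
    M.Feasible (M.policy W α) :=
  hM.bestBonus_mem _

theorem Standing.armLoss_policy (hM : M.Standing) (W : ℝ → ℝ) (α : ℝ) :
    M.armLoss α (M.policy W α).arm = 0 := by
  rcases le_or_gt M.cutPF α with h | h
  · simpa [policy, h] using hM.armLoss_risky_eq_zero_iff.2 h
  · simpa [policy, h.not_ge] using hM.armLoss_safe_eq_zero_iff.2 h.le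

namespace IsFreeBoundarySolution

theorem bellman_policy (hW : M.IsFreeBoundarySolution W αFN) (hM : M.Standing) {α : ℝ}
    (hα : α ∈ Ioo (0 : ℝ) 1) : M.bellman W α (M.policy W α) = M.r * W α :=
  hW.bellman_bestBonus hα (hM.armLoss_policy W α)

theorem bellmanEq (hW : M.IsFreeBoundarySolution W αFN) (hM : M.Standing) {α : ℝ}
    (hα : α ∈ Ioo (0 : ℝ) 1) : M.BellmanEq W α :=
  ⟨⟨_, hM.feasible_policy W α, hW.bellman_policy hM hα⟩,
    forall_mem_image.2 fun _ ha => hW.bellman_le hM hα ha⟩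

theorem isBellmanOptimal_iff (hW : M.IsFreeBoundarySolution W αFN) (hM : M.Standing) {α : ℝ}
    (hα : α ∈ Ioo (0 : ℝ) 1) {a : StageAction} :
    M.IsBellmanOptimal W α a ↔ M.Feasible a ∧ M.bellman W α a = M.r * W α := by
  refine and_congr_right fun ha => ⟨fun hmax => ?_, fun heq b hb => ?_⟩
  · exact (hW.bellman_le hM hα ha).antisymm
      (hW.bellman_policy hM hα ▸ hmax _ (hM.feasible_policy W α))
  · rw [heq]
    exact hW.bellman_le hM hα hb

theorem continuous_bonus (hW : M.IsFreeBoundarySolution W αFN) (hM : M.Standing)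
    (hα₀ : α₀ ∈ Ioo (0 : ℝ) 1) :
    Continuous fun R => (M.policy W (M.beliefAt α₀ R)).bonus := by
  have hreport : ContinuousOn (M.reportValue W) (Ioo 0 1) := by
    have hvalue := hW.contDiffOn.continuousOn
    have hderiv := hW.continuousOn_deriv
    unfold reportValue
    fun_prop
  have hcomp : Continuous fun R => M.reportValue W (M.beliefAt α₀ R) :=
    hreport.comp_continuous (continuous_beliefAt hα₀) (beliefAt_mem hα₀)
  exact continuous_iff_continuousAt.2 fun R =>
    (hM.bestBonus_continuousAt (hW.reportValue_lt _ (beliefAt_mem hα₀ R))).comp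
      (f := fun R => M.reportValue W (M.beliefAt α₀ R)) hcomp.continuousAt

theorem exists_reports (hW : M.IsFreeBoundarySolution W αFN) (hM : M.Standing)
    (hα₀ : α₀ ∈ Ioo (0 : ℝ) 1) :
    ∃ R : ℝ → ℝ, Continuous R ∧ ∀ t, 0 ≤ t →
      ∫ u in (0 : ℝ)..t, M.H (M.policy W (M.beliefAt α₀ (R u))).bonus = R t := by
  have hfeas (R : ℝ) : M.Feasible (M.policy W (M.beliefAt α₀ R)) := hM.feasible_policy W _
  have hH : Continuous fun R => M.H (M.policy W (M.beliefAt α₀ R)).bonus :=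
    hM.H_continuousOn.comp_continuous (hW.continuous_bonus hM hα₀) hfeas
  obtain ⟨R, hR₀, hR⟩ := exists_forward_solution (C := 1)
    (F := fun _ R => M.H (M.policy W (M.beliefAt α₀ R)).bonus) (hH.comp continuous_snd)
    (fun _ R => (abs_of_nonneg (hM.H_nonneg (hfeas R))).trans_le (hM.H_le_one (hfeas R))) 0 0
  have hR_cont : Continuous R := continuous_iff_continuousAt.2 fun t => (hR t).continuousAt
  refine ⟨R, hR_cont, fun t ht => ?_⟩
  have hderiv : ∀ u ∈ uIcc 0 t,
      HasDerivAt R (M.H (M.policy W (M.beliefAt α₀ (R u))).bonus) u := fun u hu => by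
    rw [uIcc_of_le ht] at hu
    simpa only [max_eq_left hu.1] using hR u
  rw [intervalIntegral.integral_eq_sub_of_hasDerivAt hderiv
    ((hH.comp hR_cont).intervalIntegrable 0 t), hR₀, sub_zero]

theorem exists_plan (hW : M.IsFreeBoundarySolution W αFN) (hM : M.Standing)
    (hα₀ : α₀ ∈ Ioo (0 : ℝ) 1) :
    ∃ P : M.Plan, ∀ t, 0 ≤ t → P.act t = M.policy W (P.belief α₀ t) := by
  obtain ⟨R, hR_cont, hR⟩ := hW.exists_reports hM hα₀
  let P : M.Plan :=
    { act := fun t => M.policy W (M.beliefAt α₀ (R t))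
      arm_measurable := by
        simp only [policy_arm_eq_risky_iff]
        exact (isClosed_le continuous_const
          ((continuous_beliefAt hα₀).comp hR_cont)).measurableSet
      bonus_measurable := ((hW.continuous_bonus hM hα₀).comp hR_cont).measurable
      feasible := fun t => hM.feasible_policy W _ }
  have hreports {t : ℝ} (ht : 0 ≤ t) : P.reports t = R t := hR t ht
  refine ⟨P, fun t ht => ?_⟩
  change M.policy W (M.beliefAt α₀ (R t)) = M.policy W (M.beliefAt α₀ (P.reports t))
  rw [hreports ht]

theorem profit_eq_of_forall_act_eq (hW : M.IsFreeBoundarySolution W αFN) (hM : M.Standing)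
    (hα₀ : α₀ ∈ Ioo (0 : ℝ) 1) {P : M.Plan}
    (hP : ∀ t, 0 ≤ t → P.act t = M.policy W (P.belief α₀ t)) : P.profit α₀ = W α₀ := by
  rw [hW.profit_eq hM hα₀ P, setIntegral_eq_zero_of_forall_eq_zero, sub_zero]
  intro t ht
  rw [Plan.shortfall, hP t (le_of_lt ht), hW.bellman_policy hM (P.belief_mem hα₀ t), sub_self,
    mul_zero]

theorem isOptimal_of_forall_act_eq (hW : M.IsFreeBoundarySolution W αFN) (hM : M.Standing)
    (hα₀ : α₀ ∈ Ioo (0 : ℝ) 1) {P : M.Plan}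
    (hP : ∀ t, 0 ≤ t → P.act t = M.policy W (P.belief α₀ t)) : P.IsOptimal α₀ := fun Q => by
  rw [hW.profit_eq_of_forall_act_eq hM hα₀ hP]
  exact hW.profit_le hM hα₀ Q

theorem profit_eq_of_isOptimal (hW : M.IsFreeBoundarySolution W αFN) (hM : M.Standing)
    (hα₀ : α₀ ∈ Ioo (0 : ℝ) 1) {P : M.Plan} (hP : P.IsOptimal α₀) : P.profit α₀ = W α₀ := by
  obtain ⟨Q, hQ⟩ := hW.exists_plan hM hα₀
  exact (hW.profit_le hM hα₀ P).antisymm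
    (hW.profit_eq_of_forall_act_eq hM hα₀ hQ ▸ hP Q)

theorem ae_prescribed_of_isOptimal (hW : M.IsFreeBoundarySolution W αFN) (hM : M.Standing)
    (hα₀ : α₀ ∈ Ioo (0 : ℝ) 1) {P : M.Plan} (hP : P.IsOptimal α₀) :
    ∀ᵐ t ∂(volume.restrict (Ioi (0 : ℝ))),
      M.Prescribed M.cutSP M.cutPF αFN (P.belief α₀ t) (P.act t) := by
  filter_upwards [hW.ae_bellman_eq hM hα₀ (hW.profit_eq_of_isOptimal hM hα₀ hP)] with t ht
  exact hW.prescribed hM (P.belief_mem hα₀ t) (P.feasible t) ht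

theorem value_eqOn (hW : M.IsFreeBoundarySolution W αFN) (hM : M.Standing) :
    EqOn M.value W (Ioo 0 1) := by
  intro α hα
  obtain ⟨P, hP⟩ := hW.exists_plan hM hα
  have hmax : IsGreatest (range fun Q : M.Plan => Q.profit α) (W α) :=
    ⟨⟨P, hW.profit_eq_of_forall_act_eq hM hα hP⟩, forall_mem_range.2 (hW.profit_le hM hα)⟩
  exact hmax.csSup_eq

end IsFreeBoundarySolution

theorem Standing.exists_isFreeBoundarySolution_value (hM : M.Standing) :
    ∃ αFN, M.IsFreeBoundarySolution M.value αFN := by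
  obtain ⟨W, αFN, hW⟩ := hM.exists_isFreeBoundarySolution
  exact ⟨αFN, hW.congr (hW.value_eqOn hM)⟩

end Market

theorem mainTheorem1 (M : Market) (hM : M.Standing) :
    ∃ αSP αPF αFN : ℝ,
      -- the cutoffs
      αSP = M.s * M.r / (M.lam * (M.g - M.s) + M.r * M.g) ∧
      αPF = M.s / (M.lam * M.z) ∧
      IsLeast {x | x ∈ Ioo (0 : ℝ) 1 ∧ M.value x = x * M.z * M.lam / M.r} αFN ∧
      0 < αSP ∧ αSP < αPF ∧ αPF < αFN ∧ αFN < 1 ∧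
      -- the value function: continuously differentiable (also at the cutoffs), a solution of the
      -- Bellman equation, and made of the four branches
      ContDiffOn ℝ 1 M.value (Ioo 0 1) ∧
      (∀ α ∈ Ioo (0 : ℝ) 1, M.BellmanEq M.value α) ∧
      (∀ α ∈ Ioc 0 αSP, M.value α = M.s / M.r) ∧
      (∀ α ∈ Icc αSP αPF, M.ArmEq Arm.safe M.value α) ∧
      (∀ α ∈ Icc αPF αFN, M.ArmEq Arm.risky M.value α) ∧
      (∀ α ∈ Ico αFN 1, M.value α = α * M.z * M.lam / M.r) ∧
      -- maximizers in the Bellman equation are of the prescribed type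
      (∀ α ∈ Ioo (0 : ℝ) 1, ∀ a, M.IsBellmanOptimal M.value α a →
        M.Prescribed αSP αPF αFN α a) ∧
      -- a policy that selects such maximizers is optimal for the lifetime profit from every prior
      (∃ σ : ℝ → StageAction,
        (∀ α ∈ Ioo (0 : ℝ) 1, M.IsBellmanOptimal M.value α (σ α)) ∧
        ∀ α₀ ∈ Ioo (0 : ℝ) 1, ∃ P : M.Plan,
          (∀ t, 0 ≤ t → P.act t = σ (P.belief α₀ t)) ∧ P.IsOptimal α₀) ∧
      -- every optimal plan uses the prescribed strategy at almost every time
      (∀ α₀ ∈ Ioo (0 : ℝ) 1, ∀ P : M.Plan, P.IsOptimal α₀ →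
        ∀ᵐ t ∂(volume.restrict (Ioi (0 : ℝ))),
          M.Prescribed αSP αPF αFN (P.belief α₀ t) (P.act t)) := by
  obtain ⟨αFN, hW⟩ := hM.exists_isFreeBoundarySolution_value
  refine ⟨M.cutSP, M.cutPF, αFN, rfl, rfl, hW.isLeast_eq_risky hM, hM.cutSP_pos,
    hM.cutSP_lt_cutPF, hW.cutPF_lt, hW.lt_one, hW.contDiffOn,
    fun α hα => hW.bellmanEq hM hα, fun α hα => hW.eq_safe hM hα, fun α hα => ?_, fun α hα => ?_,
    fun α hα => hW.eq_risky hM hα, fun α hα a ha => ?_,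
    ⟨M.policy M.value, fun α hα => ?_, fun α₀ hα₀ => ?_⟩,
    fun α₀ hα₀ P hP => hW.ae_prescribed_of_isOptimal hM hα₀ hP⟩
  · have hα' : α ∈ Ioo (0 : ℝ) 1 :=
      ⟨hM.cutSP_pos.trans_le hα.1, (hα.2.trans_lt hW.cutPF_lt).trans hW.lt_one⟩
    exact hW.armEq hM hα' (hM.armLoss_safe_eq_zero_iff.2 hα.2)
  · have hα' : α ∈ Ioo (0 : ℝ) 1 :=
      ⟨(hM.cutSP_pos.trans hM.cutSP_lt_cutPF).trans_le hα.1, hα.2.trans_lt hW.lt_one⟩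
    exact hW.armEq hM hα' (hM.armLoss_risky_eq_zero_iff.2 hα.1)
  · obtain ⟨hfeas, heq⟩ := (hW.isBellmanOptimal_iff hM hα).1 ha
    exact hW.prescribed hM hα hfeas heq
  · exact (hW.isBellmanOptimal_iff hM hα).2 ⟨hM.feasible_policy _ α, hW.bellman_policy hM hα⟩
  · obtain ⟨P, hP⟩ := hW.exists_plan hM hα₀
    exact ⟨P, hP, hW.isOptimal_of_forall_act_eq hM hα₀ hP⟩
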